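/- For a finite group $G$, let $\mathrm{Rep}(G)$ be the $C^*$-tensor category of finite-dimensional unitary representations of $G$. Two finite groups are *monoidally equivalent* if their representation categories are equivalent as $C^*$-tensor categories, i.e. there are unitary tensor functors (linear, $*$-preserving, with unitary structure isomorphisms) in both directions whose composites are isomorphic to the identity functors by unitary monoidal natural isomorphisms. The *order list* of $G$ is $(D^{(d_1)},\dots,D^{(d_m)})$, where $d_1<\dots<d_m$ are the divisors of $|G|$ and $D^{(d)}$ is the number of elements of $G$ of order $d$. Let $G_1,G_2,G_3,G_4$ be the groups generated by $f_1,\dots,f_6$ subject to the following relations on products of generators; in each group, $f_5^2=f_6^2=1$, and $f_jf_i=f_if_j$ for all $i<j$ for which no other relation is listed. * $G_1$: $f_1^2=f_5,\ f_2^2=f_6,\ f_3^2=f_4^2=1,\ f_2f_1=f_1f_2f_5,\ f_3f_1=f_1f_3f_6,\ f_4f_2=f_2f_4f_5$ (this is the Izumi–Kosaki group); * $G_2$: $f_1^2=1,\ f_2^2=f_6,\ f_3^2=f_4^2=f_5,\ f_2f_1=f_1f_2f_5,\ f_3f_1=f_1f_3f_6,\ f_4f_2=f_2f_4f_5$ (its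 monoidally equivalent partner); * $G_3$: $f_1^2=f_2^2=f_3^2=f_4^2=1,\ f_2f_1=f_1f_2f_5,\ f_3f_1=f_1f_3f_6,\ f_3f_2=f_2f_3f_5,\ f_4f_1=f_1f_4f_5$; * $G_4$: $f_1^2=f_3^2=f_4^2=1,\ f_2^2=f_5,\ f_2f_1=f_1f_2f_5,\ f_3f_1=f_1f_3f_6,\ f_3f_2=f_2f_3f_5,\ f_4f_1=f_1f_4f_5$. For a finite abelian normal subgroup $N\trianglelefteq G$ with dual group $\widehat N$, a *2-cocycle* on $\widehat N$ is a map $\omega\colon\widehat N\times\widehat N\to\mathbb T$ with $\omega(\rho,\sigma)\,\omega(\rho\sigma,\tau)=\omega(\sigma,\tau)\,\omega(\rho,\sigma\tau)$. It is *non-degenerate* if $\sigma=1$ is the only $\sigma\in\widehat N$ with $\omega(\sigma,\tau)\overline{\omega(\tau,\sigma)}=1$ for all $\tau\in\widehat N$. It is *$G$-invariant* if for every $g\in G$ there is $\xi\colon\widehat N\to\mathbb T$ with $\omega(\sigma^g,\tau^g)\overline{\omega(\sigma,\tau)}=\xi(\sigma)\xi(\tau)\overline{\xi(\sigma\tau)}$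 for all $\sigma,\tau$, where $\sigma^g(n)=\sigma(gng^{-1})$. By the Fourier isomorphism $\mathbb C[N]\cong C(\widehat N)$, $\omega$ is regarded as a unitary element of $\mathbb C[N]\otimes\mathbb C[N]\subseteq\mathbb C[G]\otimes\mathbb C[G]$. The *twist* $G^\omega$ is the finite quantum group dual to $\mathbb C[G]$ with the coproduct $\Delta^\omega(a)=\omega^*\Delta(a)\,\omega$; a group $H$ is isomorphic to $G^\omega$ if there is a $*$-algebra isomorphism $\Phi\colon\mathbb C[H]\to\mathbb C[G]$ with $\Delta^\omega\circ\Phi=(\Phi\otimes\Phi)\circ\Delta$. **Theorem.** The groups $G_3$ and $G_4$ have order $64$. They are not isomorphic, but they are monoidally equivalent, and both have order list $(1,31,32,0,0,0,0)$. Moreover, there are a normal subgroup $N\cong C_2^{\times4}$ of $G_3$, a $G_3$-invariant non-degenerate 2-cocycle $\omega$ on $\widehat N$, and an isomorphism $G_4\cong G_3^\omega$, given by some $\Phi\colon\mathbb C[G_4]\to\mathbb C[G_3]$ as above, such that a monoidal equivalence $\mathrm{Rep}(G_3)\simeq\mathrm{Rep}(G_4)$ comes from this twist: up to a natural unitary identification,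 its functor keeps the underlying Hilbert spaces and intertwiners, lets $G_4$ act through $\Phi$, and has the action of $\omega$ on $U\otimes V$ as its tensor structure. Finally, neither $G_3$ nor $G_4$ is isomorphic to $G_1$ or $G_2$, so that $\{G_3,G_4\}$ is a pair different from the Izumi–Kosaki pair. -/

import Mathlib

open CategoryTheory MonoidalCategory
open scoped TensorProduct

noncomputable section

/-! ### Finite-dimensional unitary representations -/

/-- A finite-dimensional unitary representation of `G`: a finite-dimensional complex Hilbert
space together with a homomorphism from `G` to its unitary group. -/
structure UnitaryRep (G : Type) [Group G] : Type 1 where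
  carrier : Type
  [normed : NormedAddCommGroup carrier]
  [innerProduct : InnerProductSpace ℂ carrier]
  [finite : FiniteDimensional ℂ carrier]
  ρ : G →* (carrier ≃ₗᵢ[ℂ] carrier)

namespace UnitaryRep

variable {G : Type} [Group G]

instance : CoeSort (UnitaryRep G) Type := ⟨carrier⟩

instance (U : UnitaryRep G) : NormedAddCommGroup U := U.normed

instance (U : UnitaryRep G) : InnerProductSpace ℂ U := U.innerProduct

instance (U : UnitaryRep G) : FiniteDimensional ℂ U := U.finite

/-- The space of intertwiners from `U` to `V`. -/
def mor (U V : UnitaryRep G) : Submodule ℂ (U →ₗ[ℂ] V) where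
  carrier := {T | ∀ (g : G) (x : U), T (U.ρ g x) = V.ρ g (T x)}
  add_mem' := by
    intro S T hS hT g x
    simp [hS g x, hT g x]
  zero_mem' := by
    intro g x
    simp
  smul_mem' := by
    intro c T hT g x
    simp [hT g x]

/-- The category of finite-dimensional unitary representations, with the intertwiners as
morphisms. -/
instance : Category (UnitaryRep G) where
  Hom U V := mor U V
  id U := ⟨LinearMap.id, fun _ _ => rfl⟩
  comp f g := ⟨g.1 ∘ₗ f.1, fun a x => by
    simp [f.2 a x, g.2 a (f.1 x)]⟩

/-- The linear map underlying a morphism. -/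
def lin {U V : UnitaryRep G} (f : U ⟶ V) : U →ₗ[ℂ] V := f.1

theorem lin_ext {U V : UnitaryRep G} {f g : U ⟶ V} (h : lin f = lin g) : f = g := Subtype.ext h

theorem lin_rho {U V : UnitaryRep G} (f : U ⟶ V) (g : G) (x : U) :
    lin f (U.ρ g x) = V.ρ g (lin f x) := f.2 g x

/-- A linear map commuting with the two actions, as a morphism. -/
def homMk {U V : UnitaryRep G} (T : U →ₗ[ℂ] V)
    (h : ∀ (g : G) (x : U), T (U.ρ g x) = V.ρ g (T x)) : U ⟶ V := ⟨T, h⟩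

@[simp] theorem lin_homMk {U V : UnitaryRep G} (T : U →ₗ[ℂ] V)
    (h : ∀ (g : G) (x : U), T (U.ρ g x) = V.ρ g (T x)) : lin (homMk T h) = T := rfl

@[simp] theorem lin_id (U : UnitaryRep G) : lin (𝟙 U) = LinearMap.id := rfl

@[simp] theorem lin_comp {U V W : UnitaryRep G} (f : U ⟶ V) (g : V ⟶ W) :
    lin (f ≫ g) = lin g ∘ₗ lin f := rfl

instance : Preadditive (UnitaryRep G) where
  homGroup U V := inferInstanceAs (AddCommGroup (mor U V))
  add_comp _ _ _ f f' g := Subtype.ext (LinearMap.comp_add f.1 f'.1 g.1)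
  comp_add _ _ _ f g g' := Subtype.ext (LinearMap.add_comp f.1 g'.1 g.1)

instance : Linear ℂ (UnitaryRep G) where
  homModule U V := inferInstanceAs (Module ℂ (mor U V))
  smul_comp _ _ _ r f g := Subtype.ext (LinearMap.comp_smul g.1 r f.1)
  comp_smul _ _ _ f r g := Subtype.ext (LinearMap.smul_comp r g.1 f.1)

/-- A linear equivalence commuting with the two actions, as an isomorphism. -/
def isoMk {U V : UnitaryRep G} (e : U ≃ₗ[ℂ] V)
    (h : ∀ (g : G) (x : U), e (U.ρ g x) = V.ρ g (e x)) : U ≅ V where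
  hom := homMk e.toLinearMap h
  inv := homMk e.symm.toLinearMap (fun g y => by
    apply e.injective
    simp [h])
  hom_inv_id := lin_ext (by ext x; simp)
  inv_hom_id := lin_ext (by ext x; simp)

/-- The tensor product of representations, on the Hilbert space tensor product. -/
def tensor (U V : UnitaryRep G) : UnitaryRep G where
  carrier := U ⊗[ℂ] V
  ρ :=
    { toFun := fun g => TensorProduct.congrIsometry (U.ρ g) (V.ρ g)
      map_one' := by
        rw [map_one, map_one]
        exact TensorProduct.congrIsometry_refl_refl
      map_mul' := by
        intro g h
        ext x
        induction x using TensorProduct.induction_on with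
        | zero => simp
        | tmul x y => rw [map_mul, map_mul]; rfl
        | add x y hx hy => rw [map_add, map_add, hx, hy] }

/-- The trivial one-dimensional representation. -/
def trivial : UnitaryRep G where
  carrier := ℂ
  ρ := 1

/-- The tensor product of two intertwiners. -/
def tensorMap {U U' V V' : UnitaryRep G} (f : U ⟶ U') (g : V ⟶ V') :
    tensor U V ⟶ tensor U' V' :=
  homMk (U := tensor U V) (V := tensor U' V') (TensorProduct.map (lin f) (lin g)) (by
    intro a x
    change (TensorProduct.map (lin f) (lin g)) (TensorProduct.congrIsometry (U.ρ a) (V.ρ a) x) =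
      TensorProduct.congrIsometry (U'.ρ a) (V'.ρ a) (TensorProduct.map (lin f) (lin g) x)
    induction x using TensorProduct.induction_on with
    | zero => simp
    | tmul x y => simp [lin_rho]
    | add x y hx hy => rw [map_add, map_add, hx, hy, map_add, map_add])

theorem tensor_hom_ext {U V W : UnitaryRep G} {f g : tensor U V ⟶ W}
    (h : ∀ (x : U) (y : V), lin f (x ⊗ₜ[ℂ] y : U ⊗[ℂ] V) = lin g (x ⊗ₜ[ℂ] y : U ⊗[ℂ] V)) :
    f = g :=
  lin_ext (TensorProduct.ext' (R := ℂ) (M := U) (N := V) h)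

theorem tensor_hom_ext₃ {U V W X : UnitaryRep G} {f g : tensor (tensor U V) W ⟶ X}
    (h : ∀ (x : U) (y : V) (z : W),
      lin f (x ⊗ₜ[ℂ] y ⊗ₜ[ℂ] z : (U ⊗[ℂ] V) ⊗[ℂ] W) =
        lin g (x ⊗ₜ[ℂ] y ⊗ₜ[ℂ] z : (U ⊗[ℂ] V) ⊗[ℂ] W)) :
    f = g :=
  lin_ext (TensorProduct.ext_threefold (R := ℂ) (M := U) (N := V) (P := W) h)

theorem tensor_hom_ext₄ {U V W X Y : UnitaryRep G} {f g : tensor (tensor (tensor U V) W) X ⟶ Y}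
    (h : ∀ (x : U) (y : V) (z : W) (w : X),
      lin f (x ⊗ₜ[ℂ] y ⊗ₜ[ℂ] z ⊗ₜ[ℂ] w : ((U ⊗[ℂ] V) ⊗[ℂ] W) ⊗[ℂ] X) =
        lin g (x ⊗ₜ[ℂ] y ⊗ₜ[ℂ] z ⊗ₜ[ℂ] w : ((U ⊗[ℂ] V) ⊗[ℂ] W) ⊗[ℂ] X)) :
    f = g :=
  lin_ext (TensorProduct.ext_fourfold (R := ℂ) (M := U) (N := V) (P := W) (Q := X) h)

/-- The associativity isomorphism. -/
def assocIso (U V W : UnitaryRep G) : tensor (tensor U V) W ≅ tensor U (tensor V W) :=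
  isoMk (U := tensor (tensor U V) W) (V := tensor U (tensor V W))
    (TensorProduct.assoc ℂ U V W) (by
      intro a x
      refine LinearMap.congr_fun (f := (TensorProduct.assoc ℂ U V W).toLinearMap ∘ₗ
        ((tensor (tensor U V) W).ρ a).toLinearEquiv.toLinearMap)
        (g := ((tensor U (tensor V W)).ρ a).toLinearEquiv.toLinearMap ∘ₗ
          (TensorProduct.assoc ℂ U V W).toLinearMap) ?_ x
      apply TensorProduct.ext_threefold
      intro x y z
      rfl)

/-- The left unit isomorphism. -/
def lidIso (U : UnitaryRep G) : tensor trivial U ≅ U :=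
  isoMk (U := tensor trivial U) (V := U) (TensorProduct.lid ℂ U) (by
      intro a x
      refine LinearMap.congr_fun (f := (TensorProduct.lid ℂ U).toLinearMap ∘ₗ
        ((tensor trivial U).ρ a).toLinearEquiv.toLinearMap)
        (g := (U.ρ a).toLinearEquiv.toLinearMap ∘ₗ (TensorProduct.lid ℂ U).toLinearMap) ?_ x
      apply TensorProduct.ext'
      intro c y
      exact (map_smul (U.ρ a) (show ℂ from c) y).symm)

/-- The right unit isomorphism. -/
def ridIso (U : UnitaryRep G) : tensor U trivial ≅ U :=
  isoMk (U := tensor U trivial) (V := U) (TensorProduct.rid ℂ U) (by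
      intro a x
      refine LinearMap.congr_fun (f := (TensorProduct.rid ℂ U).toLinearMap ∘ₗ
        ((tensor U trivial).ρ a).toLinearEquiv.toLinearMap)
        (g := (U.ρ a).toLinearEquiv.toLinearMap ∘ₗ (TensorProduct.rid ℂ U).toLinearMap) ?_ x
      apply TensorProduct.ext'
      intro y c
      exact (map_smul (U.ρ a) (show ℂ from c) y).symm)

/-- Tensor products, unit object, associators and unitors of unitary representations, given by
those of the underlying vector spaces. -/
instance : MonoidalCategoryStruct (UnitaryRep G) where
  tensorObj := tensor
  tensorHom := tensorMap
  whiskerLeft U _ _ f := tensorMap (𝟙 U) f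
  whiskerRight f V := tensorMap f (𝟙 V)
  tensorUnit := trivial
  associator := assocIso
  leftUnitor := lidIso
  rightUnitor := ridIso

theorem lin_tensorMap_tmul {U U' V V' : UnitaryRep G} (f : U ⟶ U') (g : V ⟶ V') (x : U) (y : V) :
    lin (tensorMap f g) (x ⊗ₜ[ℂ] y : U ⊗[ℂ] V) = (lin f x ⊗ₜ[ℂ] lin g y : U' ⊗[ℂ] V') := rfl

theorem lin_assocIso_tmul (U V W : UnitaryRep G) (x : U) (y : V) (z : W) :
    lin (assocIso U V W).hom (x ⊗ₜ[ℂ] y ⊗ₜ[ℂ] z : (U ⊗[ℂ] V) ⊗[ℂ] W) =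
      (x ⊗ₜ[ℂ] (y ⊗ₜ[ℂ] z) : U ⊗[ℂ] (V ⊗[ℂ] W)) := rfl

theorem lin_lidIso_tmul (U : UnitaryRep G) (c : ℂ) (x : U) :
    lin (lidIso U).hom (c ⊗ₜ[ℂ] x : ℂ ⊗[ℂ] U) = c • x := rfl

theorem lin_ridIso_tmul (U : UnitaryRep G) (x : U) (c : ℂ) :
    lin (ridIso U).hom (x ⊗ₜ[ℂ] c : U ⊗[ℂ] ℂ) = c • x := rfl

theorem pentagon_aux (U V W X : UnitaryRep G) :
    tensorMap (assocIso U V W).hom (𝟙 X) ≫ (assocIso U (tensor V W) X).hom ≫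
      tensorMap (𝟙 U) (assocIso V W X).hom =
    (assocIso (tensor U V) W X).hom ≫ (assocIso U V (tensor W X)).hom :=
  tensor_hom_ext₄ fun _ _ _ _ => rfl

theorem triangle_aux (U V : UnitaryRep G) :
    (assocIso U trivial V).hom ≫ tensorMap (𝟙 U) (lidIso V).hom =
      tensorMap (ridIso U).hom (𝟙 V) :=
  tensor_hom_ext₃ fun x c y => (TensorProduct.smul_tmul (R := ℂ) (show ℂ from c) x y).symm

theorem assoc_naturality_aux {U₁ U₂ U₃ V₁ V₂ V₃ : UnitaryRep G} (f₁ : U₁ ⟶ V₁) (f₂ : U₂ ⟶ V₂)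
    (f₃ : U₃ ⟶ V₃) :
    tensorMap (tensorMap f₁ f₂) f₃ ≫ (assocIso V₁ V₂ V₃).hom =
      (assocIso U₁ U₂ U₃).hom ≫ tensorMap f₁ (tensorMap f₂ f₃) :=
  tensor_hom_ext₃ fun _ _ _ => rfl

theorem lid_naturality_aux {U V : UnitaryRep G} (f : U ⟶ V) :
    tensorMap (𝟙 trivial) f ≫ (lidIso V).hom = (lidIso U).hom ≫ f :=
  tensor_hom_ext fun c x => (map_smul (lin f) (show ℂ from c) x).symm

theorem rid_naturality_aux {U V : UnitaryRep G} (f : U ⟶ V) :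
    tensorMap f (𝟙 trivial) ≫ (ridIso V).hom = (ridIso U).hom ≫ f :=
  tensor_hom_ext fun x c => (map_smul (lin f) (show ℂ from c) x).symm

instance : MonoidalCategory (UnitaryRep G) := MonoidalCategory.ofTensorHom
  (id_tensorHom_id := fun _ _ => tensor_hom_ext fun _ _ => rfl)
  (id_tensorHom := fun _ _ _ _ => rfl)
  (tensorHom_id := fun _ _ => rfl)
  (tensorHom_comp_tensorHom := fun _ _ _ _ => tensor_hom_ext fun _ _ => rfl)
  (associator_naturality := assoc_naturality_aux)
  (leftUnitor_naturality := lid_naturality_aux)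
  (rightUnitor_naturality := rid_naturality_aux)
  (pentagon := pentagon_aux)
  (triangle := triangle_aux)

/-- The adjoint of an intertwiner. -/
def dagger {U V : UnitaryRep G} (f : U ⟶ V) : V ⟶ U :=
  homMk (LinearMap.adjoint (lin f)) (by
    intro g y
    refine ext_inner_right ℂ fun x => ?_
    have h1 : ∀ (W : UnitaryRep G) (a b : W),
        inner ℂ (W.ρ g a) b = inner ℂ a (W.ρ g⁻¹ b) := by
      intro W a b
      have h2 : W.ρ g (W.ρ g⁻¹ b) = b := by
        change (W.ρ g * W.ρ g⁻¹) b = b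
        rw [← map_mul, mul_inv_cancel, map_one]
        rfl
      rw [← (W.ρ g).inner_map_map a (W.ρ g⁻¹ b), h2]
    rw [LinearMap.adjoint_inner_left, h1, h1, LinearMap.adjoint_inner_left, lin_rho])

/-- A morphism is unitary if its adjoint is its inverse. -/
def IsUnitary {U V : UnitaryRep G} (f : U ⟶ V) : Prop :=
  f ≫ dagger f = 𝟙 U ∧ dagger f ≫ f = 𝟙 V

end UnitaryRep

/-! ### Monoidal equivalence -/

/-- A unitary tensor functor between representation categories: a linear, `*`-preserving functor
whose monoidal structure isomorphisms are unitary. -/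
structure IsUnitaryTensorFunctor {G H : Type} [Group G] [Group H]
    (F : UnitaryRep G ⥤ UnitaryRep H) [F.Monoidal] : Prop where
  map_add : ∀ {U V : UnitaryRep G} (f g : U ⟶ V), F.map (f + g) = F.map f + F.map g
  map_smul : ∀ {U V : UnitaryRep G} (c : ℂ) (f : U ⟶ V), F.map (c • f) = c • F.map f
  map_dagger : ∀ {U V : UnitaryRep G} (f : U ⟶ V),
    F.map (UnitaryRep.dagger f) = UnitaryRep.dagger (F.map f)
  unitary_ε : UnitaryRep.IsUnitary (Functor.LaxMonoidal.ε F)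
  unitary_μ : ∀ U V : UnitaryRep G, UnitaryRep.IsUnitary (Functor.LaxMonoidal.μ F U V)

/-- An equivalence `Rep G ≌ Rep H` of C⋆-tensor categories: a pair of unitary tensor functors
whose two composites are isomorphic to the identity functors through unitary monoidal natural
isomorphisms. -/
structure RepEquivalence (G H : Type) [Group G] [Group H] where
  equiv : UnitaryRep G ≌ UnitaryRep H
  [functorMonoidal : equiv.functor.Monoidal]
  [inverseMonoidal : equiv.inverse.Monoidal]
  [isMonoidal : equiv.IsMonoidal]
  functor_unitary : IsUnitaryTensorFunctor equiv.functor
  inverse_unitary : IsUnitaryTensorFunctor equiv.inverse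
  unit_unitary : ∀ U : UnitaryRep G, UnitaryRep.IsUnitary (equiv.unitIso.hom.app U)
  counit_unitary : ∀ V : UnitaryRep H, UnitaryRep.IsUnitary (equiv.counitIso.hom.app V)

instance {G H : Type} [Group G] [Group H] (E : RepEquivalence G H) : E.equiv.functor.Monoidal :=
  E.functorMonoidal

/-- Two groups are monoidally equivalent (isocategorical) if their categories of
finite-dimensional unitary representations are equivalent as C⋆-tensor categories. -/
def MonoidallyEquivalent (G H : Type) [Group G] [Group H] : Prop :=
  Nonempty (RepEquivalence G H)

/-! ### 2-cocycles on the dual of a normal subgroup -/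

section Cocycles

variable {G : Type} [Group G]

/-- The group of characters of `N`, for finite abelian `N` its Pontryagin dual. -/
abbrev CharGroup (N : Subgroup G) : Type := N →* Circle

/-- A `𝕋`-valued 2-cocycle on the dual group of `N`. -/
def IsTwoCocycle {N : Subgroup G} (ω : CharGroup N → CharGroup N → Circle) : Prop :=
  ∀ ρ σ τ : CharGroup N, ω ρ σ * ω (ρ * σ) τ = ω σ τ * ω ρ (σ * τ)

/-- Equivalence (cohomology) of 2-cocycles on the dual group of `N`. -/
def CocycleEquiv {N : Subgroup G} (ω₁ ω₂ : CharGroup N → CharGroup N → Circle) : Prop :=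
  ∃ ξ : CharGroup N → Circle, ∀ σ τ : CharGroup N,
    ω₁ σ τ * (ω₂ σ τ)⁻¹ = ξ σ * ξ τ * (ξ (σ * τ))⁻¹

/-- The character `σ^g`, `n ↦ σ (g n g⁻¹)`. -/
def conjChar {N : Subgroup G} [N.Normal] (g : G) (σ : CharGroup N) : CharGroup N :=
  σ.comp (MulAut.conjNormal g).toMonoidHom

/-- `ω` is `G`-invariant: every translate `ω^g (σ, τ) = ω (σ^g, τ^g)` is equivalent to `ω`. -/
def IsInvariantCocycle {N : Subgroup G} [N.Normal]
    (ω : CharGroup N → CharGroup N → Circle) : Prop :=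
  ∀ g : G, CocycleEquiv (fun σ τ => ω (conjChar g σ) (conjChar g τ)) ω

/-- `ω` is non-degenerate: the bicharacter `β (σ, τ) = ω (σ, τ) ω (τ, σ)⁻¹` has trivial
radical. -/
def IsNondegenerateCocycle {N : Subgroup G} (ω : CharGroup N → CharGroup N → Circle) : Prop :=
  ∀ σ : CharGroup N, (∀ τ : CharGroup N, ω σ τ * (ω τ σ)⁻¹ = 1) → σ = 1

/-- The idempotent `|N|⁻¹ ∑ₙ σ(n)⁻¹ n` of `ℂ[N] ⊆ ℂ[G]`; under the Fourier isomorphism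
`ℂ[N] ≅ C(N̂)` it is the indicator function of `σ`. -/
def charIdempotent {N : Subgroup G} (σ : CharGroup N) : MonoidAlgebra ℂ G :=
  ∑ᶠ n : N, MonoidAlgebra.single (n : G) ((Nat.card N : ℂ)⁻¹ * ((σ n)⁻¹ : Circle))

/-- A function on `N̂ × N̂`, regarded as an element of `ℂ[N] ⊗ ℂ[N] ⊆ ℂ[G] ⊗ ℂ[G]` by the Fourier
isomorphism. -/
def cocycleElement {N : Subgroup G} (ω : CharGroup N → CharGroup N → Circle) :
    MonoidAlgebra ℂ G ⊗[ℂ] MonoidAlgebra ℂ G :=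
  ∑ᶠ p : CharGroup N × CharGroup N,
    (ω p.1 p.2 : ℂ) • (charIdempotent p.1 ⊗ₜ[ℂ] charIdempotent p.2)

/-- The twisted coproduct `Δ^ω (a) = ω* Δ(a) ω` on `ℂ[G]`. As `ω` is unitary, `ω*` corresponds to
the pointwise inverse of `ω`. -/
def twistedComul {N : Subgroup G} (ω : CharGroup N → CharGroup N → Circle)
    (a : MonoidAlgebra ℂ G) : MonoidAlgebra ℂ G ⊗[ℂ] MonoidAlgebra ℂ G :=
  cocycleElement (fun σ τ => (ω σ τ)⁻¹) * Coalgebra.comul (R := ℂ) a * cocycleElement ω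

/-- The involution of `ℂ[G]`, `(∑ a_g g)* = ∑ conj(a_g) g⁻¹`. -/
def groupStar (a : MonoidAlgebra ℂ G) : MonoidAlgebra ℂ G :=
  a.coeff.sum fun g c => MonoidAlgebra.single g⁻¹ (starRingEnd ℂ c)

/-- An isomorphism of the group `H` with the twist `G^ω` of `G`: an isomorphism of finite quantum
groups (a `*`-algebra isomorphism intertwining the coproducts) from `(ℂ[H], Δ)` to
`(ℂ[G], Δ^ω)`, the dual of `G^ω`. -/
structure TwistIso (H : Type) [Group H] {N : Subgroup G}
    (ω : CharGroup N → CharGroup N → Circle) where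
  toAlgEquiv : MonoidAlgebra ℂ H ≃ₐ[ℂ] MonoidAlgebra ℂ G
  map_star : ∀ a, toAlgEquiv (groupStar a) = groupStar (toAlgEquiv a)
  map_comul : ∀ a, twistedComul ω (toAlgEquiv a) =
    TensorProduct.map toAlgEquiv.toLinearMap toAlgEquiv.toLinearMap (Coalgebra.comul (R := ℂ) a)

/-- The action of `ℂ[G]` on (the Hilbert space of) a unitary representation of `G`. -/
def UnitaryRep.algAction (U : UnitaryRep G) : MonoidAlgebra ℂ G →ₐ[ℂ] Module.End ℂ U :=
  MonoidAlgebra.lift ℂ (Module.End ℂ U) G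
    { toFun := fun g => (U.ρ g).toLinearEquiv.toLinearMap
      map_one' := by rw [map_one]; rfl
      map_mul' := fun g h => by rw [map_mul]; rfl }

/-- The action of `ℂ[G] ⊗ ℂ[G]` on the tensor product of two unitary representations of `G`. -/
def UnitaryRep.tensorAction (U V : UnitaryRep G) :
    MonoidAlgebra ℂ G ⊗[ℂ] MonoidAlgebra ℂ G →ₐ[ℂ] Module.End ℂ (U ⊗[ℂ] V) :=
  (Module.endTensorEndAlgHom (R := ℂ) (S := ℂ) (A := ℂ) (M := U) (N := V)).comp
    (Algebra.TensorProduct.map U.algAction V.algAction)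

/-- The equivalence `E : Rep G ≌ Rep H` is the one given by twisting with `ω`: up to a natural
unitary identification `θ`, the functor keeps the underlying Hilbert spaces and intertwiners,
lets `H` act through `Φ : ℂ[H] ≅ ℂ[G]`, and its tensor structure `E U ⊗ E V ⟶ E (U ⊗ V)` is the
action of `ω ∈ ℂ[G] ⊗ ℂ[G]` on `U ⊗ V`. -/
def RepEquivalence.ComesFromTwist {H : Type} [Group H] (E : RepEquivalence G H) {N : Subgroup G}
    {ω : CharGroup N → CharGroup N → Circle} (Φ : TwistIso H ω) : Prop :=
  ∃ θ : ∀ U : UnitaryRep G, U ≃ₗᵢ[ℂ] E.equiv.functor.obj U,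
    (∀ (U V : UnitaryRep G) (f : U ⟶ V) (x : U),
      UnitaryRep.lin (E.equiv.functor.map f) (θ U x) = θ V (UnitaryRep.lin f x)) ∧
    (∀ (U : UnitaryRep G) (h : H) (x : U),
      (E.equiv.functor.obj U).ρ h (θ U x) =
        θ U (U.algAction (Φ.toAlgEquiv (MonoidAlgebra.single h 1)) x)) ∧
    (∀ (U V : UnitaryRep G) (x : U) (y : V),
      UnitaryRep.lin (Functor.LaxMonoidal.μ E.equiv.functor U V) (θ U x ⊗ₜ[ℂ] θ V y) =
        θ (U ⊗ V) (UnitaryRep.tensorAction U V (cocycleElement ω) (x ⊗ₜ[ℂ] y)))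

end Cocycles

/-! ### Order lists -/

/-- The order list of a finite group: the numbers of elements of order `d`, for the divisors `d`
of the group order in increasing order. -/
def orderList (G : Type) [Group G] : List ℕ :=
  ((Nat.card G).divisors.sort (· ≤ ·)).map fun d => Nat.card {g : G // orderOf g = d}

/-! ### Groups given by tables of products of six generators -/

/-- The group with generators `f₁, …, f₆` (here indexed by `0, …, 5`) and the relations
`fᵢ fⱼ = t i j`, where a list of indices stands for the product of the corresponding generators. -/
abbrev TableGroup (t : Fin 6 → Fin 6 → List (Fin 6)) : Type :=
  PresentedGroup (Set.range fun p : Fin 6 × Fin 6 =>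
    FreeGroup.of p.1 * FreeGroup.of p.2 * (((t p.1 p.2).map FreeGroup.of).prod)⁻¹)

def table1 : Fin 6 → Fin 6 → List (Fin 6) :=
  ![![[4],       [0, 1],    [0, 2], [0, 3], [0, 4], [0, 5]],
    ![[0, 1, 4], [5],       [1, 2], [1, 3], [1, 4], [1, 5]],
    ![[0, 2, 5], [1, 2],    [],     [2, 3], [2, 4], [2, 5]],
    ![[0, 3],    [1, 3, 4], [2, 3], [],     [3, 4], [3, 5]],
    ![[0, 4],    [1, 4],    [2, 4], [3, 4], [],     [4, 5]],
    ![[0, 5],    [1, 5],    [2, 5], [3, 5], [4, 5], []]]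

def table2 : Fin 6 → Fin 6 → List (Fin 6) :=
  ![![[],        [0, 1],    [0, 2], [0, 3], [0, 4], [0, 5]],
    ![[0, 1, 4], [5],       [1, 2], [1, 3], [1, 4], [1, 5]],
    ![[0, 2, 5], [1, 2],    [4],    [2, 3], [2, 4], [2, 5]],
    ![[0, 3],    [1, 3, 4], [2, 3], [4],    [3, 4], [3, 5]],
    ![[0, 4],    [1, 4],    [2, 4], [3, 4], [],     [4, 5]],
    ![[0, 5],    [1, 5],    [2, 5], [3, 5], [4, 5], []]]

def table3 : Fin 6 → Fin 6 → List (Fin 6) :=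
  ![![[],        [0, 1],    [0, 2], [0, 3], [0, 4], [0, 5]],
    ![[0, 1, 4], [],        [1, 2], [1, 3], [1, 4], [1, 5]],
    ![[0, 2, 5], [1, 2, 4], [],     [2, 3], [2, 4], [2, 5]],
    ![[0, 3, 4], [1, 3],    [2, 3], [],     [3, 4], [3, 5]],
    ![[0, 4],    [1, 4],    [2, 4], [3, 4], [],     [4, 5]],
    ![[0, 5],    [1, 5],    [2, 5], [3, 5], [4, 5], []]]

def table4 : Fin 6 → Fin 6 → List (Fin 6) :=
  ![![[],        [0, 1],    [0, 2], [0, 3], [0, 4], [0, 5]],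
    ![[0, 1, 4], [4],       [1, 2], [1, 3], [1, 4], [1, 5]],
    ![[0, 2, 5], [1, 2, 4], [],     [2, 3], [2, 4], [2, 5]],
    ![[0, 3, 4], [1, 3],    [2, 3], [],     [3, 4], [3, 5]],
    ![[0, 4],    [1, 4],    [2, 4], [3, 4], [],     [4, 5]],
    ![[0, 5],    [1, 5],    [2, 5], [3, 5], [4, 5], []]]

/-- The Izumi–Kosaki group. -/
abbrev G1 : Type := TableGroup table1

/-- The partner of the Izumi–Kosaki group. -/
abbrev G2 : Type := TableGroup table2

abbrev G3 : Type := TableGroup table3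

abbrev G4 : Type := TableGroup table4

end

/-! Structure of the groups. Each presentation maps onto an explicit central extension of 𝔽₂⁴ (the
classes of f₁,…,f₄) by 𝔽₂² (f₅ and f₆) with a bilinear cocycle, a group of order 64. For `G3` and
`G4` a normal-form count gives at most 64 elements (`TableGroup.card_le`), so the map is bijective
and squares, commutators and orders become finite computations over 𝔽₂. The equation x² = 1 has 32
solutions in `G3` and `G4`, but 20 in the models of `G1` and `G2`. With exponent 4 this gives the
order lists and separates the two pairs. `G3` and `G4` are told apart by centralizers of elements of
order 4: all have 16 elements in `G3`, one has 32 in `G4`.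

The twist. Let N = ⟨f₃,f₄,f₅,f₆⟩ in `G3`. For commuting involutions A, B put s(A,B) = (1+A+B−AB)/2,
which is −1 where A = B = −1 and 1 elsewhere; it is multiplicative in each argument. The cocycle is
the bicharacter ω whose Fourier image is W = s(f₃⊗1, 1⊗f₅) · s(f₆⊗1, 1⊗f₄), a self-adjoint
involution. Conjugation by f₁ sends f₃ to f₃f₆ and f₄ to f₅f₄, and the two extra factors s(f₆⊗1,
1⊗f₅) cancel. Conjugation by f₂ sends f₃ to f₅f₃ and multiplies W by s(f₅⊗1, 1⊗f₅). The other
generators commute with W.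

The extra factor for f₂ is a coboundary. Let p be the central unitary equal to 1 where f₅ = 1 and to
i where f₅ = −1; then Δ(p) · s(f₅⊗1, 1⊗f₅) = p⊗p (`comul_phase_I`). Hence pf₂ is group-like for the
twisted coproduct, as are the other generators, and p² = f₅ turns f₂² = 1 into (pf₂)² = f₅ while
centrality of p preserves the remaining relations. These are the relations of `G4`, so f₂ ↦ pf₂
defines ℂ[`G4`] ≅ ℂ[`G3`], with inverse given by −i in place of i.

The equivalence. Pulling representations back along this isomorphism keeps spaces and intertwiners.
The action of W is a unitary tensor structure: `twistElement_mul_twist` gives equivariance, and the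
multiplicativity of s gives associativity (`controlledSign_cocycle`,
`UnitaryRep.signElement_assoc`). -/

noncomputable section

/-! ### The involution of the group algebra, its action on unitary representations, and pullback -/

theorem groupStar_single {G : Type} [Group G] (g : G) (c : ℂ) :
    groupStar (MonoidAlgebra.single g c) = MonoidAlgebra.single g⁻¹ (starRingEnd ℂ c) := by
  simp [groupStar]

theorem groupStar_add {G : Type} [Group G] (a b : MonoidAlgebra ℂ G) :
    groupStar (a + b) = groupStar a + groupStar b := by
  classical
  simp only [groupStar, MonoidAlgebra.coeff_add]
  exact Finsupp.sum_add_index' (by simp) (by simp [MonoidAlgebra.single_add])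

theorem groupStar_zero {G : Type} [Group G] : groupStar (0 : MonoidAlgebra ℂ G) = 0 := by
  simp [groupStar]

theorem groupStar_mul {G : Type} [Group G] (a b : MonoidAlgebra ℂ G) :
    groupStar (a * b) = groupStar b * groupStar a := by
  induction a using MonoidAlgebra.induction_linear with
  | zero => simp [groupStar_zero]
  | add a a' h h' => rw [add_mul, groupStar_add, h, h', groupStar_add, mul_add]
  | single g c =>
    induction b using MonoidAlgebra.induction_linear with
    | zero => simp [groupStar_zero]
    | add b b' h h' => rw [mul_add, groupStar_add, h, h', groupStar_add, add_mul]
    | single h d =>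
      simp [groupStar_single, MonoidAlgebra.single_mul_single, mul_comm]

theorem groupStar_smul {G : Type} [Group G] (c : ℂ) (a : MonoidAlgebra ℂ G) :
    groupStar (c • a) = starRingEnd ℂ c • groupStar a := by
  induction a using MonoidAlgebra.induction_linear with
  | zero => simp [groupStar_zero]
  | add a a' h h' => rw [smul_add, groupStar_add, h, h', groupStar_add, smul_add]
  | single g d => simp [groupStar_single]

namespace UnitaryRep

variable {G H : Type} [Group G] [Group H]

theorem algAction_single (U : UnitaryRep G) (g : G) (c : ℂ) (x : U) :
    U.algAction (MonoidAlgebra.single g c) x = c • U.ρ g x := by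
  simp [algAction]

theorem algAction_single_one (U : UnitaryRep G) (g : G) (x : U) :
    U.algAction (MonoidAlgebra.single g 1) x = U.ρ g x := by
  rw [algAction_single, one_smul]

theorem algAction_eq (U : UnitaryRep G) (f : MonoidAlgebra ℂ G →ₐ[ℂ] Module.End ℂ U)
    (h : ∀ (g : G) (x : U), f (MonoidAlgebra.single g 1) x = U.ρ g x) (a : MonoidAlgebra ℂ G) :
    U.algAction a = f a := by
  have h' : U.algAction = f := by
    refine MonoidAlgebra.algHom_ext (fun g => LinearMap.ext fun x => ?_) (by ext)
    rw [algAction_single_one, h]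
  rw [h']

theorem tensorAction_tmul (U V : UnitaryRep G) (a b : MonoidAlgebra ℂ G) :
    tensorAction U V (a ⊗ₜ b) = TensorProduct.map (U.algAction a) (V.algAction b) := by
  simp only [tensorAction, AlgHom.comp_apply, Algebra.TensorProduct.map_tmul]
  rfl

theorem lin_algAction {U V : UnitaryRep G} (f : U ⟶ V) (a : MonoidAlgebra ℂ G) (x : U) :
    lin f (U.algAction a x) = V.algAction a (lin f x) := by
  induction a using MonoidAlgebra.induction_linear with
  | zero => simp
  | add a b ha hb => simp [ha, hb]
  | single g c => simp [algAction_single, lin_rho]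

theorem inner_rho_left (U : UnitaryRep G) (g : G) (x y : U) :
    inner ℂ (U.ρ g x) y = inner ℂ x (U.ρ g⁻¹ y) := by
  have h : U.ρ g (U.ρ g⁻¹ y) = y := by
    change (U.ρ g * U.ρ g⁻¹) y = y
    rw [← map_mul, mul_inv_cancel, map_one]
    rfl
  rw [← (U.ρ g).inner_map_map x (U.ρ g⁻¹ y), h]

/-- This makes the pullback along a `*`-preserving homomorphism a representation by unitaries. -/
theorem inner_algAction_left (U : UnitaryRep G) (a : MonoidAlgebra ℂ G) (x y : U) :
    inner ℂ (U.algAction a x) y = inner ℂ x (U.algAction (groupStar a) y) := by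
  induction a using MonoidAlgebra.induction_linear with
  | zero => simp [groupStar_zero]
  | add a b ha hb =>
    rw [groupStar_add, map_add, map_add, LinearMap.add_apply, LinearMap.add_apply,
      inner_add_left, inner_add_right, ha, hb]
  | single g c =>
    rw [groupStar_single, algAction_single, algAction_single, inner_smul_left, inner_smul_right,
      inner_rho_left]

/-- Both sides are algebra homomorphisms in `a` that agree on group elements. Equivariance of a
tensor structure thereby becomes an identity in ℂ[G] ⊗ ℂ[G]. -/
theorem algAction_tensor (U V : UnitaryRep G) (a : MonoidAlgebra ℂ G) :
    (tensor U V).algAction a = tensorAction U V (Coalgebra.comul (R := ℂ) a) := by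
  refine algAction_eq (tensor U V)
    ((tensorAction U V).comp (Bialgebra.comulAlgHom ℂ (MonoidAlgebra ℂ G))) (fun g x => ?_) a
  have h : (Bialgebra.comulAlgHom ℂ (MonoidAlgebra ℂ G)) (MonoidAlgebra.single g 1) =
      MonoidAlgebra.single g 1 ⊗ₜ MonoidAlgebra.single g 1 := by
    simp
  change tensorAction U V (Bialgebra.comulAlgHom ℂ (MonoidAlgebra ℂ G)
    (MonoidAlgebra.single g 1)) x = _
  rw [h, tensorAction_tmul]
  refine LinearMap.congr_fun (f := TensorProduct.map (U.algAction (MonoidAlgebra.single g 1))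
    (V.algAction (MonoidAlgebra.single g 1)))
    (g := ((tensor U V).ρ g).toLinearEquiv.toLinearMap) (TensorProduct.ext' fun x y => ?_) x
  rw [TensorProduct.map_tmul, algAction_single_one, algAction_single_one]
  rfl

theorem algAction_trivial (a : MonoidAlgebra ℂ G) (x : ℂ) :
    (trivial (G := G)).algAction a (show trivial (G := G) from x) =
      Coalgebra.counit (R := ℂ) a * x := by
  rw [algAction_eq (trivial (G := G))
    ((Algebra.lmul ℂ ℂ).comp (Bialgebra.counitAlgHom ℂ (MonoidAlgebra ℂ G))) (fun g x => ?_) a]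
  · rfl
  · change Coalgebra.counit (R := ℂ) (MonoidAlgebra.single g (1 : ℂ)) * (show ℂ from x) = x
    rw [MonoidAlgebra.counit_single]
    exact one_mul (show ℂ from x)

/-- The unitary representation of `H` on the space of `U` through a `*`-preserving homomorphism
from `H` to the group algebra of `G`. -/
def pullback (φ : H →* MonoidAlgebra ℂ G) (hφ : ∀ h, groupStar (φ h) = φ h⁻¹)
    (U : UnitaryRep G) : UnitaryRep H where
  carrier := U
  ρ :=
    { toFun := fun h => LinearEquiv.isometryOfInner
        (LinearEquiv.ofLinearMap (U.algAction (φ h)) (U.algAction (φ h⁻¹))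
          (by rw [← Module.End.mul_eq_comp, ← map_mul, ← map_mul]; simp; rfl)
          (by rw [← Module.End.mul_eq_comp, ← map_mul, ← map_mul]; simp; rfl))
        (fun x y => by
          simp only [LinearEquiv.coe_ofLinearMap]
          rw [inner_algAction_left, hφ, ← Module.End.mul_apply, ← map_mul, ← map_mul]
          simp)
      map_one' := by ext x; simp
      map_mul' := fun g h => by ext x; simp }

/-- Pulling back representations along a `*`-preserving homomorphism from `H` to the group
algebra of `G`, keeping the intertwiners. -/
def pullbackFunctor (φ : H →* MonoidAlgebra ℂ G) (hφ : ∀ h, groupStar (φ h) = φ h⁻¹) :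
    UnitaryRep G ⥤ UnitaryRep H where
  obj := pullback φ hφ
  map {U V} f := homMk (U := pullback φ hφ U) (V := pullback φ hφ V) (lin (U := U) (V := V) f)
    fun h x => lin_algAction f (φ h) x

theorem pullback_algAction (φ : H →* MonoidAlgebra ℂ G) (hφ : ∀ h, groupStar (φ h) = φ h⁻¹)
    (U : UnitaryRep G) (a : MonoidAlgebra ℂ H) :
    (pullback φ hφ U).algAction a =
      U.algAction (MonoidAlgebra.lift ℂ (MonoidAlgebra ℂ G) H φ a) := by
  refine algAction_eq (pullback φ hφ U)
    (U.algAction.comp (MonoidAlgebra.lift ℂ (MonoidAlgebra ℂ G) H φ)) (fun h x => ?_) a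
  change U.algAction (MonoidAlgebra.lift ℂ (MonoidAlgebra ℂ G) H φ (MonoidAlgebra.single h 1)) x = _
  rw [MonoidAlgebra.lift_single, one_smul]
  rfl

theorem IsUnitary.comp {U V W : UnitaryRep G} {f : U ⟶ V} {g : V ⟶ W} (hf : IsUnitary f)
    (hg : IsUnitary g) : IsUnitary (f ≫ g) := by
  have h : dagger (f ≫ g) = dagger g ≫ dagger f := lin_ext (LinearMap.adjoint_comp _ _)
  constructor
  · rw [h, Category.assoc, reassoc_of% hg.1, hf.1]
  · rw [h, Category.assoc, reassoc_of% hf.2, hg.2]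

theorem isUnitary_of_norm {U V : UnitaryRep G} (e : U ≅ V)
    (h : ∀ x y : U, inner ℂ (lin e.hom x) (lin e.hom y) = inner ℂ x y) : IsUnitary e.hom := by
  have h1 : e.hom ≫ dagger e.hom = 𝟙 U := by
    refine lin_ext (LinearMap.ext fun x => ext_inner_right ℂ fun y => ?_)
    change inner ℂ (LinearMap.adjoint (lin e.hom) (lin e.hom x)) y = inner ℂ x y
    rw [LinearMap.adjoint_inner_left, h]
  refine ⟨h1, ?_⟩
  -- A one-sided inverse of an isomorphism is its inverse, so isometry alone suffices.
  have h2 : dagger e.hom = e.inv := by rw [← cancel_epi e.hom, h1, e.hom_inv_id]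
  rw [h2, e.inv_hom_id]

end UnitaryRep

/-! ### Tensor structures on pullback functors -/

namespace UnitaryRep

variable {G H : Type} [Group G] [Group H]

/-- Mutually inverse `*`-isomorphisms between the group algebras of `G` and `H` induce an
equivalence between the representation categories. -/
def pullbackEquivalence (φ : H →* MonoidAlgebra ℂ G) (hφ : ∀ h, groupStar (φ h) = φ h⁻¹)
    (ψ : G →* MonoidAlgebra ℂ H) (hψ : ∀ g, groupStar (ψ g) = ψ g⁻¹)
    (hφψ : ∀ g, MonoidAlgebra.lift ℂ _ H φ (ψ g) = MonoidAlgebra.single g 1)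
    (hψφ : ∀ h, MonoidAlgebra.lift ℂ _ G ψ (φ h) = MonoidAlgebra.single h 1) :
    UnitaryRep G ≌ UnitaryRep H where
  functor := pullbackFunctor φ hφ
  inverse := pullbackFunctor ψ hψ
  unitIso := NatIso.ofComponents
    (fun U => isoMk (U := U) (V := pullback ψ hψ (pullback φ hφ U)) (LinearEquiv.refl ℂ U)
      fun g x => by
        change U.ρ g x = (pullback φ hφ U).algAction (ψ g) x
        rw [pullback_algAction, hφψ]
        exact (algAction_single_one U g x).symm)
    (fun f => rfl)
  counitIso := NatIso.ofComponents
    (fun V => isoMk (U := pullback φ hφ (pullback ψ hψ V)) (V := V) (LinearEquiv.refl ℂ V)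
      fun h x => by
        change (pullback ψ hψ V).algAction (φ h) x = V.ρ h x
        rw [pullback_algAction, hψφ]
        exact algAction_single_one V h x)
    (fun f => rfl)
  functor_unitIso_comp U := rfl

/-- The conditions under which the action of `W` is a unitary tensor structure on the functor
given by `φ`. -/
structure IsTensorStructure (φ : H →* MonoidAlgebra ℂ G)
    (W : MonoidAlgebra ℂ G ⊗[ℂ] MonoidAlgebra ℂ G) : Prop where
  mul_self : W * W = 1
  symmetric : ∀ (U V : UnitaryRep G) (x y : U ⊗[ℂ] V),
    inner ℂ (tensorAction U V W x) y = inner ℂ x (tensorAction U V W y)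
  mul_map : ∀ h, W * (φ h ⊗ₜ φ h) = Coalgebra.comul (R := ℂ) (φ h) * W
  counit_map : ∀ h, Coalgebra.counit (R := ℂ) (φ h) = 1
  left_unit : ∀ (U : UnitaryRep G) (c : ℂ) (x : U),
    tensorAction trivial U W ((show trivial from c) ⊗ₜ[ℂ] x) = (show trivial from c) ⊗ₜ[ℂ] x
  right_unit : ∀ (U : UnitaryRep G) (c : ℂ) (x : U),
    tensorAction U trivial W (x ⊗ₜ[ℂ] (show trivial from c)) = x ⊗ₜ[ℂ] (show trivial from c)
  assoc : ∀ (U V X : UnitaryRep G) (x : U) (y : V) (z : X),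
    TensorProduct.assoc ℂ U V X
      (tensorAction (tensor U V) X W (tensorAction U V W (x ⊗ₜ[ℂ] y) ⊗ₜ[ℂ] z)) =
    tensorAction U (tensor V X) W (x ⊗ₜ[ℂ] tensorAction V X W (y ⊗ₜ[ℂ] z))

/-- Naturality of the tensor structure: intertwiners commute with the whole group algebra in each
leg. -/
theorem map_tensorAction {U U' V V' : UnitaryRep G} (f : U ⟶ U') (g : V ⟶ V')
    (W : MonoidAlgebra ℂ G ⊗[ℂ] MonoidAlgebra ℂ G) (x : U ⊗[ℂ] V) :
    TensorProduct.map (lin f) (lin g) (tensorAction U V W x) =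
      tensorAction U' V' W (TensorProduct.map (lin f) (lin g) x) := by
  induction W using TensorProduct.induction_on with
  | zero => simp
  | add a b ha hb => simp only [map_add, LinearMap.add_apply, ha, hb]
  | tmul a b =>
    rw [tensorAction_tmul, tensorAction_tmul]
    induction x using TensorProduct.induction_on with
    | zero => simp
    | add x y hx hy => simp only [map_add, hx, hy]
    | tmul x y => simp [lin_algAction]

namespace IsTensorStructure

variable {φ : H →* MonoidAlgebra ℂ G} {W : MonoidAlgebra ℂ G ⊗[ℂ] MonoidAlgebra ℂ G}

theorem tensorAction_tensorAction (hW : IsTensorStructure φ W) (U V : UnitaryRep G)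
    (x : U ⊗[ℂ] V) : tensorAction U V W (tensorAction U V W x) = x := by
  rw [← Module.End.mul_apply, ← map_mul, hW.mul_self, map_one, Module.End.one_apply]

/-- The tensor structure `F U ⊗ F V ≅ F (U ⊗ V)`. -/
def tensorIso (hW : IsTensorStructure φ W) (hφ : ∀ h, groupStar (φ h) = φ h⁻¹)
    (U V : UnitaryRep G) :
    tensor (pullback φ hφ U) (pullback φ hφ V) ≅ pullback φ hφ (tensor U V) :=
  isoMk (U := tensor (pullback φ hφ U) (pullback φ hφ V)) (V := pullback φ hφ (tensor U V))
    (LinearEquiv.ofLinearMap (M := U ⊗[ℂ] V) (M₂ := U ⊗[ℂ] V) (tensorAction U V W)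
      (tensorAction U V W) (LinearMap.ext (hW.tensorAction_tensorAction U V))
      (LinearMap.ext (hW.tensorAction_tensorAction U V)))
    fun h x => by
      change tensorAction U V W
        (TensorProduct.map (U.algAction (φ h)) (V.algAction (φ h)) x) =
          (tensor U V).algAction (φ h) (tensorAction U V W x)
      rw [algAction_tensor, ← tensorAction_tmul]
      change (tensorAction U V W * tensorAction U V (φ h ⊗ₜ φ h)) x =
        (tensorAction U V (Coalgebra.comul (R := ℂ) (φ h)) * tensorAction U V W) x
      rw [← map_mul, ← map_mul, hW.mul_map]

/-- The unit isomorphism. -/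
def unitIso (hW : IsTensorStructure φ W) (hφ : ∀ h, groupStar (φ h) = φ h⁻¹) :
    (trivial : UnitaryRep H) ≅ pullback φ hφ trivial :=
  isoMk (U := trivial) (V := pullback φ hφ trivial) (LinearEquiv.refl ℂ ℂ) fun h x => by
    change x = (trivial (G := G)).algAction (φ h) (show ℂ from x)
    refine Eq.symm ((algAction_trivial (φ h) x).trans ?_)
    rw [hW.counit_map]
    exact one_mul (show ℂ from x)

/-- The monoidal structure on the pullback functor. -/
def coreMonoidal (hW : IsTensorStructure φ W) (hφ : ∀ h, groupStar (φ h) = φ h⁻¹) :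
    (pullbackFunctor φ hφ).CoreMonoidal where
  εIso := hW.unitIso hφ
  μIso := hW.tensorIso hφ
  μIso_hom_natural_left f X := lin_ext <| LinearMap.ext fun x =>
    (map_tensorAction f (𝟙 X) W x).symm
  μIso_hom_natural_right X f := lin_ext <| LinearMap.ext fun x =>
    (map_tensorAction (𝟙 X) f W x).symm
  associativity U V X := tensor_hom_ext₃ fun x y z => hW.assoc U V X x y z
  left_unitality U := tensor_hom_ext fun c x =>
    (congrArg (TensorProduct.lid ℂ U) (hW.left_unit U c x)).symm
  right_unitality U := tensor_hom_ext fun x c =>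
    (congrArg (TensorProduct.rid ℂ U) (hW.right_unit U c x)).symm

theorem isUnitary_tensorIso (hW : IsTensorStructure φ W) (hφ : ∀ h, groupStar (φ h) = φ h⁻¹)
    (U V : UnitaryRep G) : IsUnitary (hW.tensorIso hφ U V).hom :=
  isUnitary_of_norm _ fun x y => by
    exact (hW.symmetric U V x _).trans (congrArg (inner ℂ (show U ⊗[ℂ] V from x))
      (hW.tensorAction_tensorAction U V y))

theorem isUnitary_unitIso (hW : IsTensorStructure φ W) (hφ : ∀ h, groupStar (φ h) = φ h⁻¹) :
    IsUnitary (hW.unitIso hφ).hom :=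
  isUnitary_of_norm _ fun _ _ => rfl

end IsTensorStructure

end UnitaryRep

/-! ### Unitary monoidal equivalences from isomorphisms of group algebras -/

namespace UnitaryRep

variable {G H : Type} [Group G] [Group H]

theorem dagger_dagger {U V : UnitaryRep G} (f : U ⟶ V) : dagger (dagger f) = f :=
  lin_ext (LinearMap.adjoint_adjoint _)

theorem IsUnitary.dagger {U V : UnitaryRep G} {f : U ⟶ V} (hf : IsUnitary f) :
    IsUnitary (dagger f) := by
  unfold IsUnitary
  rw [dagger_dagger]
  exact ⟨hf.2, hf.1⟩

theorem IsUnitary.inv {U V : UnitaryRep G} {e : U ≅ V} (he : IsUnitary e.hom) :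
    IsUnitary e.inv := by
  have h : UnitaryRep.dagger e.hom = e.inv := by rw [← cancel_epi e.hom, he.1, e.hom_inv_id]
  rw [← h]
  exact he.dagger

theorem dagger_tensorHom {U U' V V' : UnitaryRep G} (f : U ⟶ U') (g : V ⟶ V') :
    dagger (f ⊗ₘ g) = dagger f ⊗ₘ dagger g :=
  lin_ext (TensorProduct.adjoint_map _ _)

theorem IsUnitary.tensorHom {U U' V V' : UnitaryRep G} {f : U ⟶ U'} {g : V ⟶ V'}
    (hf : IsUnitary f) (hg : IsUnitary g) : IsUnitary (f ⊗ₘ g) := by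
  unfold IsUnitary
  rw [dagger_tensorHom]
  constructor
  · rw [tensorHom_comp_tensorHom, hf.1, hg.1, id_tensorHom_id]
  · rw [tensorHom_comp_tensorHom, hf.2, hg.2, id_tensorHom_id]

theorem pullbackFunctor_map_dagger (φ : H →* MonoidAlgebra ℂ G)
    (hφ : ∀ h, groupStar (φ h) = φ h⁻¹) {U V : UnitaryRep G} (f : U ⟶ V) :
    (pullbackFunctor φ hφ).map (dagger f) = dagger ((pullbackFunctor φ hφ).map f) := rfl

theorem IsUnitary.map_pullbackFunctor (φ : H →* MonoidAlgebra ℂ G)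
    (hφ : ∀ h, groupStar (φ h) = φ h⁻¹) {U V : UnitaryRep G} {f : U ⟶ V} (hf : IsUnitary f) :
    IsUnitary ((pullbackFunctor φ hφ).map f) := by
  unfold IsUnitary
  rw [← pullbackFunctor_map_dagger, ← Functor.map_comp, ← Functor.map_comp, hf.1, hf.2]
  exact ⟨rfl, rfl⟩

/-- The equivalence of C⋆-tensor categories given by mutually inverse `*`-isomorphisms of group
algebras and a tensor structure. -/
def IsTensorStructure.repEquivalence {φ : H →* MonoidAlgebra ℂ G}
    {W : MonoidAlgebra ℂ G ⊗[ℂ] MonoidAlgebra ℂ G} (hW : IsTensorStructure φ W)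
    (hφ : ∀ h, groupStar (φ h) = φ h⁻¹)
    (ψ : G →* MonoidAlgebra ℂ H) (hψ : ∀ g, groupStar (ψ g) = ψ g⁻¹)
    (hφψ : ∀ g, MonoidAlgebra.lift ℂ _ H φ (ψ g) = MonoidAlgebra.single g 1)
    (hψφ : ∀ h, MonoidAlgebra.lift ℂ _ G ψ (φ h) = MonoidAlgebra.single h 1) :
    RepEquivalence G H :=
  let e := pullbackEquivalence φ hφ ψ hψ hφψ hψφ
  letI : e.functor.Monoidal := (hW.coreMonoidal hφ).toMonoidal
  -- The inverse functor receives the structure transported along the equivalence, so compatibility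
  -- with unit and counit needs no second twist element.
  letI : e.inverse.Monoidal := e.inverseMonoidal
  have hunit : ∀ U, IsUnitary (e.unitIso.hom.app U) := fun U =>
    isUnitary_of_norm (e.unitIso.app U) fun _ _ => rfl
  have hcounit : ∀ V, IsUnitary (e.counitIso.hom.app V) := fun V =>
    isUnitary_of_norm (e.counitIso.app V) fun _ _ => rfl
  { equiv := e
    isMonoidal := ⟨rfl, fun _ _ => rfl⟩
    functor_unitary :=
      { map_add := fun _ _ => rfl
        map_smul := fun _ _ => rfl
        map_dagger := pullbackFunctor_map_dagger φ hφ
        unitary_ε := hW.isUnitary_unitIso hφ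
        unitary_μ := hW.isUnitary_tensorIso hφ }
    inverse_unitary :=
      { map_add := fun _ _ => rfl
        map_smul := fun _ _ => rfl
        map_dagger := pullbackFunctor_map_dagger ψ hψ
        -- The transported structure maps are composites of the unit, images of the inverse
        -- structure maps and, for μ, counits; each of these is unitary.
        unitary_ε := (hunit _).comp
          ((hW.isUnitary_unitIso hφ).inv.map_pullbackFunctor ψ hψ)
        unitary_μ := fun X Y => (hunit _).comp
          (((hW.isUnitary_tensorIso hφ _ _).inv.comp
            ((hcounit X).tensorHom (hcounit Y))).map_pullbackFunctor ψ hψ) }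
    unit_unitary := hunit
    counit_unitary := hcounit }

end UnitaryRep

/-! ### Calculus of controlled signs -/

section ControlledSign

variable {E : Type*} [Semiring E] [Algebra ℂ E]

/-- For commuting involutions, the operator which is `-1` where both `A` and `B` are `-1`, and `1`
elsewhere. -/
def controlledSign (A B : E) : E := (2⁻¹ : ℂ) • (1 + A + B + (-1 : ℂ) • (A * B))

theorem controlledSign_one_left (B : E) : controlledSign 1 B = 1 := by
  rw [controlledSign, one_mul]
  module

theorem controlledSign_comm {A B : E} (h : Commute A B) :
    controlledSign A B = controlledSign B A := by
  rw [controlledSign, controlledSign, h.eq, add_right_comm 1 A B]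

theorem controlledSign_one_right (A : E) : controlledSign A 1 = 1 := by
  rw [controlledSign_comm (.one_right A), controlledSign_one_left]

/-- With the complementary idempotents p = (1+B)/2 and q = (1−B)/2, the controlled sign of A and B
is p + Aq. Since A' commutes with p and q, (p + Aq)(p + A'q) = p + AA'q. -/
theorem controlledSign_mul_left (A : E) {A' B : E} (h : Commute A' B) (hB : B * B = 1) :
    controlledSign (A * A') B = controlledSign A B * controlledSign A' B := by
  have h1 : B * (A' * B) = A' := by rw [← mul_assoc, ← h.eq, mul_assoc, hB, mul_one]
  simp only [controlledSign, mul_add, add_mul, mul_smul_comm, smul_mul_assoc, mul_one,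
    one_mul, mul_assoc, h1, hB, ← h.eq]
  module

theorem controlledSign_mul_right {A B : E} (B' : E) (h : Commute A B) (h' : Commute A B')
    (hA : A * A = 1) :
    controlledSign A (B * B') = controlledSign A B * controlledSign A B' := by
  rw [controlledSign_comm (h.mul_right h'), controlledSign_mul_left B h'.symm hA,
    controlledSign_comm h, controlledSign_comm h']

theorem controlledSign_mul_self {A B : E} (h : Commute A B) (hA : A * A = 1) (hB : B * B = 1) :
    controlledSign A B * controlledSign A B = 1 := by
  rw [← controlledSign_mul_left A h hB, hA, controlledSign_one_left]

theorem Commute.controlledSign_right {X A B : E} (hA : Commute X A) (hB : Commute X B) :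
    Commute X (controlledSign A B) :=
  ((((Commute.one_right X).add_right hA).add_right hB).add_right
    ((hA.mul_right hB).smul_right _)).smul_right _

theorem Commute.controlledSign_left {X A B : E} (hA : Commute A X) (hB : Commute B X) :
    Commute (controlledSign A B) X :=
  (Commute.controlledSign_right hA.symm hB.symm).symm

theorem map_controlledSign {E' : Type*} [Semiring E'] [Algebra ℂ E'] (f : E →ₐ[ℂ] E') (A B : E) :
    f (controlledSign A B) = controlledSign (f A) (f B) := by
  simp [controlledSign]

theorem SemiconjBy.controlledSign {X A B A' B' : E} (hA : SemiconjBy X A A')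
    (hB : SemiconjBy X B B') : SemiconjBy X (controlledSign A B) (controlledSign A' B') := by
  have h := (((SemiconjBy.one_right X).add_right hA).add_right hB).add_right
    ((hA.mul_right hB).smul_right (-1 : ℂ))
  unfold SemiconjBy _root_.controlledSign
  rw [mul_smul_comm, h.eq, smul_mul_assoc]

set_option linter.unusedSimpArgs false in
/-- The cocycle identity for the product of two controlled signs on triples. -/
theorem controlledSign_cocycle {G : Type*} [Group G] (Q : G × G × G →* E) {a z w d : G}
    (ha : a * a = 1) (hz : z * z = 1) (hw : w * w = 1) (hd : d * d = 1)
    (haz : Commute a z) (haw : Commute a w) (had : Commute a d) (hzw : Commute z w)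
    (hzd : Commute z d) (hwd : Commute w d) :
    controlledSign (Q (a, a, 1)) (Q (1, 1, z)) * controlledSign (Q (w, w, 1)) (Q (1, 1, d)) *
      (controlledSign (Q (a, 1, 1)) (Q (1, z, 1)) * controlledSign (Q (w, 1, 1)) (Q (1, d, 1))) =
    controlledSign (Q (a, 1, 1)) (Q (1, z, z)) * controlledSign (Q (w, 1, 1)) (Q (1, d, d)) *
      (controlledSign (Q (1, a, 1)) (Q (1, 1, z)) * controlledSign (Q (1, w, 1)) (Q (1, 1, d))) := by
  have c : ∀ {p q : G × G × G}, Commute p.1 q.1 → Commute p.2.1 q.2.1 → Commute p.2.2 q.2.2 →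
      Commute (Q p) (Q q) := fun {p q} h1 h2 h3 =>
    Commute.map (Prod.ext h1.eq (Prod.ext h2.eq h3.eq) : p * q = q * p) Q
  have s : ∀ {p : G × G × G}, p.1 * p.1 = 1 → p.2.1 * p.2.1 = 1 → p.2.2 * p.2.2 = 1 →
      Q p * Q p = 1 := fun {p} h1 h2 h3 => by
    rw [← map_mul, (Prod.ext h1 (Prod.ext h2 h3) : p * p = 1), map_one]
  have e1 : ∀ x : G, Q (x, x, 1) = Q (x, 1, 1) * Q (1, x, 1) := fun x => by
    rw [← map_mul]; simp
  have e2 : ∀ x : G, Q (1, x, x) = Q (1, x, 1) * Q (1, 1, x) := fun x => by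
    rw [← map_mul]; simp
  -- Multiplicativity turns both sides into products of the same six signs: (a,z) and (w,d), each
  -- placed in legs 12, 13 and 23. Only their order differs.
  rw [e1 a, e1 w, e2 z, e2 d,
    controlledSign_mul_left _ (c (by simp) (by simp) (by simp)) (s (by simp) (by simp) (by simpa)),
    controlledSign_mul_left _ (c (by simp) (by simp) (by simp)) (s (by simp) (by simp) (by simpa)),
    controlledSign_mul_right _ (c (by simp) (by simp) (by simp)) (c (by simp) (by simp) (by simp))
      (s (by simpa) (by simp) (by simp)),
    controlledSign_mul_right _ (c (by simp) (by simp) (by simp)) (c (by simp) (by simp) (by simp))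
      (s (by simpa) (by simp) (by simp))]
  generalize hA : controlledSign (Q (a, 1, 1)) (Q (1, 1, z)) = A
  generalize hB : controlledSign (Q (1, a, 1)) (Q (1, 1, z)) = B
  generalize hC : controlledSign (Q (w, 1, 1)) (Q (1, 1, d)) = C
  generalize hD : controlledSign (Q (1, w, 1)) (Q (1, 1, d)) = D
  generalize hE : controlledSign (Q (a, 1, 1)) (Q (1, z, 1)) = E
  generalize hF : controlledSign (Q (w, 1, 1)) (Q (1, d, 1)) = F
  have k : ∀ {p q p' q' : G × G × G}, Commute (Q p) (Q p') → Commute (Q p) (Q q') →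
      Commute (Q q) (Q p') → Commute (Q q) (Q q') →
      Commute (controlledSign (Q p) (Q q)) (controlledSign (Q p') (Q q')) :=
    fun h1 h2 h3 h4 => .controlledSign_left (.controlledSign_right h1 h2)
      (.controlledSign_right h3 h4)
  have AE : Commute A E := by
    rw [← hA, ← hE]; apply k <;> apply c <;> simp [haz, haz.symm]
  have BE : Commute B E := by
    rw [← hB, ← hE]; apply k <;> apply c <;> simp [haz, haz.symm]
  have CE : Commute C E := by
    rw [← hC, ← hE]; apply k <;> apply c <;> simp [haw.symm, hzd.symm]
  have DE : Commute D E := by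
    rw [← hD, ← hE]; apply k <;> apply c <;> simp [hzw.symm, hzd.symm, haw.symm]
  have BC : Commute B C := by
    rw [← hB, ← hC]; apply k <;> apply c <;> simp [haw, had, hzd]
  have BF : Commute B F := by
    rw [← hB, ← hF]; apply k <;> apply c <;> simp [haw, had, hzd]
  have CF : Commute C F := by
    rw [← hC, ← hF]; apply k <;> apply c <;> simp [hwd, hwd.symm]
  have DF : Commute D F := by
    rw [← hD, ← hF]; apply k <;> apply c <;> simp [hwd, hwd.symm]
  calc A * B * (C * D) * (E * F) = A * B * (C * (D * E) * F) := by simp only [mul_assoc]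
    _ = A * (B * E) * (C * (D * F)) := by rw [DE.eq]; simp only [mul_assoc, CE.left_comm]
    _ = E * A * (B * C * F * D) := by rw [BE.eq, DF.eq]; simp only [mul_assoc, AE.left_comm]
    _ = E * A * (C * F * (B * D)) := by rw [BC.eq]; simp only [mul_assoc, BF.left_comm]
    _ = E * A * (F * C) * (B * D) := by rw [CF.eq]; simp only [mul_assoc]

end ControlledSign

/-! ### The sign element and its action on tensor products -/

section GroupAlgebra

variable {G : Type} [Group G]

/-- The group-like elements `g ⊗ h` of `ℂ[G] ⊗ ℂ[G]`. -/
def pairHom : G × G →* MonoidAlgebra ℂ G ⊗[ℂ] MonoidAlgebra ℂ G where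
  toFun p := MonoidAlgebra.single p.1 1 ⊗ₜ MonoidAlgebra.single p.2 1
  map_one' := rfl
  map_mul' p q := by
    simp [MonoidAlgebra.single_mul_single]

theorem pairHom_apply (g h : G) :
    pairHom (g, h) = MonoidAlgebra.single g (1 : ℂ) ⊗ₜ[ℂ] MonoidAlgebra.single h (1 : ℂ) := rfl

theorem pairHom_mul_self {g h : G} (hg : g * g = 1) (hh : h * h = 1) :
    pairHom (g, h) * pairHom (g, h) = 1 := by
  rw [← map_mul, Prod.mk_mul_mk, hg, hh, Prod.mk_one_one, map_one]

theorem commute_pairHom {g h g' h' : G} (hg : Commute g g') (hh : Commute h h') :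
    Commute (pairHom (g, h)) (pairHom (g', h')) :=
  Commute.map (Prod.ext hg.eq hh.eq : (g, h) * (g', h') = (g', h') * (g, h)) _

/-- The element of `ℂ[G] ⊗ ℂ[G]` given by the product of the controlled signs of `(a, z)` and
`(w, d)`. -/
def signElement (a z w d : G) : MonoidAlgebra ℂ G ⊗[ℂ] MonoidAlgebra ℂ G :=
  controlledSign (pairHom (a, 1)) (pairHom (1, z)) *
    controlledSign (pairHom (w, 1)) (pairHom (1, d))

theorem commute_signFactors {a z w d : G} (haw : Commute a w) (hzd : Commute z d) :
    Commute (controlledSign (pairHom (a, 1)) (pairHom (1, z)))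
      (controlledSign (pairHom (w, 1)) (pairHom (1, d))) :=
  .controlledSign_left
    (.controlledSign_right (commute_pairHom haw (.refl 1))
      (commute_pairHom (.one_right a) (.one_left d)))
    (.controlledSign_right (commute_pairHom (.one_left w) (.one_right z))
      (commute_pairHom (.refl 1) hzd))

theorem controlledSign_pairHom_mul_self {a z : G} (ha : a * a = 1) (hz : z * z = 1) :
    controlledSign (pairHom (a, 1)) (pairHom (1, z)) *
      controlledSign (pairHom (a, 1)) (pairHom (1, z)) = 1 :=
  controlledSign_mul_self (commute_pairHom (.one_right a) (.one_left z))
    (pairHom_mul_self ha (mul_one 1)) (pairHom_mul_self (mul_one 1) hz)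

theorem signElement_mul_self {a z w d : G}
    (ha : a * a = 1) (hz : z * z = 1) (hw : w * w = 1) (hd : d * d = 1)
    (haw : Commute a w) (hzd : Commute z d) : signElement a z w d * signElement a z w d = 1 := by
  rw [signElement, (commute_signFactors haw hzd).symm.mul_mul_mul_comm,
    controlledSign_pairHom_mul_self ha hz, controlledSign_pairHom_mul_self hw hd, one_mul]

end GroupAlgebra

namespace UnitaryRep

variable {G H : Type} [Group G] [Group H]

theorem tensorAction_pairHom (U V : UnitaryRep G) (g h : G) :
    tensorAction U V (pairHom (g, h)) =
      TensorProduct.map (U.ρ g).toLinearEquiv.toLinearMap (V.ρ h).toLinearEquiv.toLinearMap := by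
  rw [pairHom_apply, tensorAction_tmul]
  congr 1 <;> exact LinearMap.ext fun x => algAction_single_one _ _ x

theorem isSymmetric_tensorAction_pairHom (U V : UnitaryRep G) {g h : G} (hg : g * g = 1)
    (hh : h * h = 1) : (tensorAction U V (pairHom (g, h))).IsSymmetric := by
  have k : ∀ (U : UnitaryRep G) {g : G}, g * g = 1 →
      LinearMap.adjoint (U.ρ g).toLinearEquiv.toLinearMap = (U.ρ g).toLinearEquiv.toLinearMap := by
    intro U g hg
    refine LinearMap.ext fun x => ext_inner_right ℂ fun y => ?_
    rw [LinearMap.adjoint_inner_left]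
    change inner ℂ x (U.ρ g y) = inner ℂ (U.ρ g x) y
    rw [inner_rho_left, inv_eq_of_mul_eq_one_left hg]
  rw [LinearMap.isSymmetric_iff_isSelfAdjoint, tensorAction_pairHom, isSelfAdjoint_iff,
    LinearMap.star_eq_adjoint, TensorProduct.adjoint_map, k U hg, k V hh]

/-- A unitary involution is self-adjoint, and the controlled sign is a combination of such operators
with real coefficients. -/
theorem isSymmetric_tensorAction_controlledSign (U V : UnitaryRep G) {g h : G} (hg : g * g = 1)
    (hh : h * h = 1) :
    (tensorAction U V (controlledSign (pairHom (g, 1)) (pairHom (1, h)))).IsSymmetric := by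
  have h1 := isSymmetric_tensorAction_pairHom U V hg (mul_one 1)
  have h2 := isSymmetric_tensorAction_pairHom U V (mul_one 1) hh
  have h3 := isSymmetric_tensorAction_pairHom U V hg hh
  have h4 : pairHom (g, 1) * pairHom (1, h) = pairHom (g, h) := by
    rw [← map_mul, Prod.mk_mul_mk, mul_one, one_mul]
  rw [controlledSign, h4, map_smul, map_add, map_add, map_add, map_one, map_smul]
  exact (((LinearMap.IsSymmetric.one.add h1).add h2).add (h3.smul (by simp))).smul
    (by simp [map_ofNat])

/-- `g ⊗ h ⊗ k` acting on a triple tensor product. -/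
def tripleAction (U V X : UnitaryRep G) :
    G × G × G →* Module.End ℂ ((U ⊗[ℂ] V) ⊗[ℂ] X) where
  toFun p := TensorProduct.map (TensorProduct.map (U.ρ p.1).toLinearEquiv.toLinearMap
    (V.ρ p.2.1).toLinearEquiv.toLinearMap) (X.ρ p.2.2).toLinearEquiv.toLinearMap
  map_one' := TensorProduct.ext_threefold fun x y z => by simp
  map_mul' p q := TensorProduct.ext_threefold fun x y z => by simp

/-- All operators are carried to endomorphisms of (U ⊗ V) ⊗ X, those on U ⊗ (V ⊗ X) by conjugation
with the associator. There they are products of controlled signs of images of G × G × G, and the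
claim is `controlledSign_cocycle`. The diagonal entries (g, g, h) and (g, h, h) come from the action
on an inner tensor product. -/
theorem signElement_assoc {a z w d : G}
    (ha : a * a = 1) (hz : z * z = 1) (hw : w * w = 1) (hd : d * d = 1)
    (haz : Commute a z) (haw : Commute a w) (had : Commute a d) (hzw : Commute z w)
    (hzd : Commute z d) (hwd : Commute w d) (U V X : UnitaryRep G) (x : U) (y : V) (t : X) :
    TensorProduct.assoc ℂ U V X
      (tensorAction (tensor U V) X (signElement a z w d)
        (tensorAction U V (signElement a z w d) (x ⊗ₜ[ℂ] y) ⊗ₜ[ℂ] t)) =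
    tensorAction U (tensor V X) (signElement a z w d)
      (x ⊗ₜ[ℂ] tensorAction V X (signElement a z w d) (y ⊗ₜ[ℂ] t)) := by
  let Q := tripleAction U V X
  let e := TensorProduct.assoc ℂ U V X
  let L12 : Module.End ℂ (U ⊗[ℂ] V) →ₐ[ℂ] Module.End ℂ ((U ⊗[ℂ] V) ⊗[ℂ] X) :=
    Module.End.rTensorAlgHom ℂ _ _
  let L23 : Module.End ℂ (V ⊗[ℂ] X) →ₐ[ℂ] Module.End ℂ ((U ⊗[ℂ] V) ⊗[ℂ] X) :=
    ((LinearEquiv.conjAlgEquiv ℂ e.symm).toAlgHom).comp (Module.End.lTensorAlgHom ℂ _ _)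
  let L1 : Module.End ℂ (U ⊗[ℂ] (V ⊗[ℂ] X)) →ₐ[ℂ] Module.End ℂ ((U ⊗[ℂ] V) ⊗[ℂ] X) :=
    (LinearEquiv.conjAlgEquiv ℂ e.symm).toAlgHom
  let T3 : MonoidAlgebra ℂ G ⊗[ℂ] MonoidAlgebra ℂ G →ₐ[ℂ] Module.End ℂ ((U ⊗[ℂ] V) ⊗[ℂ] X) :=
    tensorAction (tensor U V) X
  let T1 : MonoidAlgebra ℂ G ⊗[ℂ] MonoidAlgebra ℂ G →ₐ[ℂ] Module.End ℂ (U ⊗[ℂ] (V ⊗[ℂ] X)) :=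
    tensorAction U (tensor V X)
  have q12 : ∀ g h, L12 (tensorAction U V (pairHom (g, h))) = Q (g, h, 1) := fun g h => by
    rw [tensorAction_pairHom]
    exact TensorProduct.ext_threefold fun x y z => by
      simp only [Q, tripleAction, MonoidHom.coe_mk, OneHom.coe_mk, map_one]
      rfl
  have q23 : ∀ g h, L23 (tensorAction V X (pairHom (g, h))) = Q (1, g, h) := fun g h => by
    rw [tensorAction_pairHom]
    exact TensorProduct.ext_threefold fun x y z => by
      simp only [Q, tripleAction, MonoidHom.coe_mk, OneHom.coe_mk, map_one]
      rfl
  have q3 : ∀ g h, T3 (pairHom (g, h)) = Q (g, g, h) := fun g h =>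
    (tensorAction_pairHom (tensor U V) X g h).trans
      (TensorProduct.ext_threefold fun x y z => rfl)
  have q1 : ∀ g h, L1 (T1 (pairHom (g, h))) = Q (g, h, h) := fun g h =>
    (congrArg L1 (tensorAction_pairHom U (tensor V X) g h)).trans
      (TensorProduct.ext_threefold fun x y z => rfl)
  have key : T3 (signElement a z w d) * L12 (tensorAction U V (signElement a z w d)) =
      L1 (T1 (signElement a z w d)) * L23 (tensorAction V X (signElement a z w d)) := by
    simp only [signElement, map_mul, map_controlledSign, q12, q23, q3, q1]
    exact controlledSign_cocycle Q ha hz hw hd haz haw had hzw hzd hwd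
  have h := congrArg e (LinearMap.congr_fun key (x ⊗ₜ y ⊗ₜ t))
  refine Eq.trans (by rfl) (h.trans ?_)
  change e (e.symm (T1 (signElement a z w d) (e (e.symm (LinearMap.lTensor U
    (tensorAction V X (signElement a z w d)) (e (x ⊗ₜ y ⊗ₜ t))))))) = _
  rw [e.apply_symm_apply, e.apply_symm_apply]
  rfl

end UnitaryRep

/-! ### The four groups: orders, non-isomorphism and order lists -/

section TableGroups

theorem TableGroup.of_mul_of (t : Fin 6 → Fin 6 → List (Fin 6)) (i j : Fin 6) :
    (PresentedGroup.of i * PresentedGroup.of j : TableGroup t) =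
      ((t i j).map PresentedGroup.of).prod := by
  have h := PresentedGroup.one_of_mem (rels := Set.range fun p : Fin 6 × Fin 6 =>
    FreeGroup.of p.1 * FreeGroup.of p.2 * (((t p.1 p.2).map FreeGroup.of).prod)⁻¹) ⟨(i, j), rfl⟩
  rw [map_mul, map_inv, mul_inv_eq_one, map_mul, map_list_prod, List.map_map] at h
  exact h

/-- The homomorphism from a table group given by elements satisfying its relations. -/
def TableGroup.lift {t : Fin 6 → Fin 6 → List (Fin 6)} {M : Type*} [Group M] (f : Fin 6 → M)
    (h : ∀ i j, f i * f j = ((t i j).map f).prod) : TableGroup t →* M :=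
  PresentedGroup.toGroup (f := f) (by
    rintro _ ⟨⟨i, j⟩, rfl⟩
    have e : FreeGroup.lift f ∘ FreeGroup.of = f := funext fun k => FreeGroup.lift_apply_of
    simp [map_list_prod, h i j, e])

@[simp] theorem TableGroup.lift_of {t : Fin 6 → Fin 6 → List (Fin 6)} {M : Type*} [Group M]
    (f : Fin 6 → M) (h : ∀ i j, f i * f j = ((t i j).map f).prod) (i : Fin 6) :
    TableGroup.lift f h (PresentedGroup.of i) = f i := PresentedGroup.toGroup.of _

/-- For K the closure of s, f normalizes K and f² lies in K, so K ∪ fK is closed under the group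
operations and contains the larger closure. -/
theorem encard_closure_insert_le {G : Type*} [Group G] (s : Set G) (f : G)
    (hf : f * f ∈ Subgroup.closure s)
    (hs : ∀ x ∈ s, ∃ y ∈ Subgroup.closure s, x * f = f * y) :
    (Subgroup.closure (insert f s) : Set G).encard ≤ 2 * (Subgroup.closure s : Set G).encard := by
  set K := Subgroup.closure s with hK
  have c1 : ∀ x ∈ K, f⁻¹ * x * f ∈ K := by
    have : K ≤ K.comap (MulAut.conj f⁻¹).toMonoidHom := by
      rw [hK, Subgroup.closure_le]
      intro x hx
      obtain ⟨y, hy, h⟩ := hs x hx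
      simpa [mul_assoc, h] using hy
    intro x hx
    simpa using this hx
  -- Conjugation by f differs from conjugation by f⁻¹ by conjugation with f² ∈ K, so one direction
  -- gives the other without finiteness.
  have c2 : ∀ x ∈ K, f * x * f⁻¹ ∈ K := fun x hx => by
    have h : f * x * f⁻¹ = (f * f) * (f⁻¹ * x * f) * (f * f)⁻¹ := by group
    rw [h]
    exact K.mul_mem (K.mul_mem hf (c1 x hx)) (K.inv_mem hf)
  have sub : (Subgroup.closure (insert f s) : Set G) ⊆ K ∪ (f * ·) '' K := by
    intro x hx
    induction hx using Subgroup.closure_induction with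
    | mem x hx =>
      rcases hx with rfl | hx
      · exact Or.inr ⟨1, K.one_mem, mul_one x⟩
      · exact Or.inl (Subgroup.subset_closure hx)
    | one => exact Or.inl K.one_mem
    | mul x y _ _ hx hy =>
      rcases hx with hx | ⟨x, hx, rfl⟩ <;> rcases hy with hy | ⟨y, hy, rfl⟩
      · exact Or.inl (K.mul_mem hx hy)
      · exact Or.inr ⟨f⁻¹ * x * f * y, K.mul_mem (c1 x hx) hy, by simp [mul_assoc]⟩
      · exact Or.inr ⟨x * y, K.mul_mem hx hy, by simp [mul_assoc]⟩
      · refine Or.inl ?_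
        have h : f * x * (f * y) = f * x * f⁻¹ * (f * f) * y := by group
        change f * x * (f * y) ∈ K
        rw [h]
        exact K.mul_mem (K.mul_mem (c2 x hx) hf) hy
    | inv x _ hx =>
      rcases hx with hx | ⟨x, hx, rfl⟩
      · exact Or.inl (K.inv_mem hx)
      · refine Or.inr ⟨(f * f)⁻¹ * (f * x⁻¹ * f⁻¹),
          K.mul_mem (K.inv_mem hf) (c2 _ (K.inv_mem hx)), ?_⟩
        simp only
        group
  calc _ ≤ _ := Set.encard_le_encard sub
    _ ≤ _ := Set.encard_union_le _ _
    _ ≤ (K : Set G).encard + (K : Set G).encard := add_le_add_right (Set.encard_image_le _ _) _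
    _ = _ := (two_mul _).symm

/-- The subgroups generated by the last n generators at most double in size with n: the hypotheses
put the square of a generator, and what remains after moving it to the front, among words in later
generators. -/
theorem TableGroup.card_le (t : Fin 6 → Fin 6 → List (Fin 6)) (ht : ∀ i, ∀ k ∈ t i i, i < k)
    (ht' : ∀ i j, i < j → (t j i).head? = some i ∧ ∀ k ∈ (t j i).tail, i < k) :
    ENat.card (TableGroup t) ≤ 64 := by
  have key : ∀ n : ℕ, n ≤ 6 → (Subgroup.closure {x : TableGroup t | ∃ k : Fin 6, 6 ≤ n + k.val ∧
      x = PresentedGroup.of k} : Set (TableGroup t)).encard ≤ 2 ^ n := by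
    intro n
    induction n with
    | zero =>
      intro _
      have h : {x : TableGroup t | ∃ k : Fin 6, 6 ≤ 0 + k.val ∧ x = PresentedGroup.of k} = ∅ := by
        ext x
        simp only [Set.mem_ofPred_eq, Set.mem_empty_iff_false, iff_false]
        rintro ⟨k, hk, -⟩
        omega
      rw [h]
      simp
    | succ n ih =>
      intro hn
      set s := {x : TableGroup t | ∃ k : Fin 6, 6 ≤ n + k.val ∧ x = PresentedGroup.of k} with hs
      -- Generators are adjoined from the last one downwards; those of index at least 6 − n are
      -- already present.
      let i : Fin 6 := ⟨5 - n, by omega⟩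
      have h : {x : TableGroup t | ∃ k : Fin 6, 6 ≤ n + 1 + k.val ∧ x = PresentedGroup.of k} =
          insert (PresentedGroup.of i) s := by
        ext x
        simp only [Set.mem_ofPred_eq, Set.mem_insert_iff, hs]
        constructor
        · rintro ⟨k, hk, rfl⟩
          by_cases h : k = i
          · exact Or.inl (by rw [h])
          · refine Or.inr ⟨k, ?_, rfl⟩
            have : k.val ≠ 5 - n := fun e => h (Fin.ext e)
            omega
        · rintro (rfl | ⟨k, hk, rfl⟩)
          · exact ⟨i, by simp only [i]; omega, rfl⟩
          · exact ⟨k, by omega, rfl⟩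
      have mem : ∀ l : List (Fin 6), (∀ k ∈ l, i < k) →
          (l.map PresentedGroup.of).prod ∈ Subgroup.closure s := by
        intro l hl
        refine Subgroup.list_prod_mem _ fun x hx => ?_
        obtain ⟨k, hk, rfl⟩ := List.mem_map.1 hx
        refine Subgroup.subset_closure ⟨k, ?_, rfl⟩
        have := hl k hk
        simp only [i, Fin.lt_def] at this
        omega
      rw [h, pow_succ']
      refine (encard_closure_insert_le s (PresentedGroup.of i) ?_ ?_).trans
        (by gcongr; exact ih (by omega))
      · rw [TableGroup.of_mul_of]
        exact mem _ (ht i)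
      · rintro _ ⟨j, hj, rfl⟩
        obtain ⟨h1, h2⟩ := ht' i j (by simp only [i, Fin.lt_def]; omega)
        refine ⟨_, mem _ h2, ?_⟩
        rw [TableGroup.of_mul_of]
        obtain ⟨l, hl⟩ := List.head?_eq_some_iff.1 h1
        simp [hl]
  have h := key 6 le_rfl
  have e : {x : TableGroup t | ∃ k : Fin 6, 6 ≤ 6 + k.val ∧ x = PresentedGroup.of k} =
      Set.range PresentedGroup.of := by
    ext x
    simp [eq_comm]
  rw [e, PresentedGroup.closure_range_of, Subgroup.coe_top, Set.encard_univ] at h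
  exact h.trans (by norm_num)

/-- The central extension of `𝔽₂⁴` by `𝔽₂²` with the bilinear 2-cocycle `b`. -/
def BilinearExtension (_b : Fin 4 → Fin 4 → Fin 2 → ZMod 2) : Type :=
  (Fin 4 → ZMod 2) × (Fin 2 → ZMod 2)

namespace BilinearExtension

variable (b : Fin 4 → Fin 4 → Fin 2 → ZMod 2)

instance : DecidableEq (BilinearExtension b) :=
  inferInstanceAs (DecidableEq ((Fin 4 → ZMod 2) × (Fin 2 → ZMod 2)))

instance : Fintype (BilinearExtension b) :=
  inferInstanceAs (Fintype ((Fin 4 → ZMod 2) × (Fin 2 → ZMod 2)))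

/-- The bilinear cocycle. -/
def form (x y : Fin 4 → ZMod 2) : Fin 2 → ZMod 2 := fun k => ∑ i, ∑ j, x i * y j * b i j k

theorem form_add_left (x x' y : Fin 4 → ZMod 2) : form b (x + x') y = form b x y + form b x' y := by
  ext k
  simp [form, add_mul, Finset.sum_add_distrib]

theorem form_add_right (x y y' : Fin 4 → ZMod 2) :
    form b x (y + y') = form b x y + form b x y' := by
  ext k
  simp [form, mul_add, add_mul, Finset.sum_add_distrib]

theorem form_neg_left (x y : Fin 4 → ZMod 2) : form b (-x) y = -form b x y := by
  ext k
  simp [form]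

theorem form_zero_left (y : Fin 4 → ZMod 2) : form b 0 y = 0 := by
  ext k
  simp [form]

instance : Mul (BilinearExtension b) := ⟨fun p q => (p.1 + q.1, p.2 + q.2 + form b p.1 q.1)⟩

instance : One (BilinearExtension b) := ⟨(0, 0)⟩

instance : Inv (BilinearExtension b) := ⟨fun p => (-p.1, -p.2 + form b p.1 p.1)⟩

theorem mul_def (p q : BilinearExtension b) :
    p * q = (p.1 + q.1, p.2 + q.2 + form b p.1 q.1) := rfl

instance : Group (BilinearExtension b) := Group.ofLeftAxioms
  (fun p q r => Prod.ext (add_assoc _ _ _) (by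
    change p.2 + q.2 + form b p.1 q.1 + r.2 + form b (p.1 + q.1) r.1 =
      p.2 + (q.2 + r.2 + form b q.1 r.1) + form b p.1 (q.1 + r.1)
    rw [form_add_left, form_add_right]
    abel))
  (fun p => Prod.ext (zero_add _) (by
    change 0 + p.2 + form b 0 p.1 = p.2
    rw [form_zero_left, zero_add, add_zero]))
  (fun p => Prod.ext (neg_add_cancel _) (by
    change -p.2 + form b p.1 p.1 + p.2 + form b (-p.1) p.1 = 0
    rw [form_neg_left]
    abel))

/-- The standard generators. -/
def gen : Fin 6 → BilinearExtension b :=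
  ![(![1, 0, 0, 0], 0), (![0, 1, 0, 0], 0), (![0, 0, 1, 0], 0), (![0, 0, 0, 1], 0),
    (0, ![1, 0]), (0, ![0, 1])]

theorem card_eq : Nat.card (BilinearExtension b) = 64 := by
  rw [BilinearExtension, Nat.card_prod]
  simp

end BilinearExtension

/-- The bilinear cocycle of the Izumi–Kosaki group. -/
def form1 : Fin 4 → Fin 4 → Fin 2 → ZMod 2 :=
  ![![![1, 0], 0, 0, 0], ![![1, 0], ![0, 1], 0, 0], ![![0, 1], 0, 0, 0], ![0, ![1, 0], 0, 0]]

/-- The bilinear cocycle of the partner of the Izumi–Kosaki group. -/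
def form2 : Fin 4 → Fin 4 → Fin 2 → ZMod 2 :=
  ![0, ![![1, 0], ![0, 1], 0, 0], ![![0, 1], 0, ![1, 0], 0], ![0, ![1, 0], 0, ![1, 0]]]

/-- The bilinear cocycle of `G3`. -/
def form3 : Fin 4 → Fin 4 → Fin 2 → ZMod 2 :=
  ![0, ![![1, 0], 0, 0, 0], ![![0, 1], ![1, 0], 0, 0], ![![1, 0], 0, 0, 0]]

/-- The bilinear cocycle of `G4`. -/
def form4 : Fin 4 → Fin 4 → Fin 2 → ZMod 2 :=
  ![0, ![![1, 0], ![1, 0], 0, 0], ![![0, 1], ![1, 0], 0, 0], ![![1, 0], 0, 0, 0]]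

open BilinearExtension in
theorem surjective_lift_gen {t : Fin 6 → Fin 6 → List (Fin 6)} {b : Fin 4 → Fin 4 → Fin 2 → ZMod 2}
    (h : ∀ i j, gen b i * gen b j = ((t i j).map (gen b)).prod)
    (hb : ∀ m : BilinearExtension b, m = gen b 0 ^ (m.1 0).val * gen b 1 ^ (m.1 1).val *
      gen b 2 ^ (m.1 2).val * gen b 3 ^ (m.1 3).val * gen b 4 ^ (m.2 0).val *
      gen b 5 ^ (m.2 1).val) :
    Function.Surjective (TableGroup.lift (gen b) h) := by
  intro m
  refine ⟨.of 0 ^ (m.1 0).val * .of 1 ^ (m.1 1).val * .of 2 ^ (m.1 2).val *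
    .of 3 ^ (m.1 3).val * .of 4 ^ (m.2 0).val * .of 5 ^ (m.2 1).val, ?_⟩
  simp only [map_mul, map_pow, TableGroup.lift_of]
  exact (hb m).symm

theorem gen_relations1 (i j : Fin 6) : BilinearExtension.gen form1 i * BilinearExtension.gen form1 j =
    ((table1 i j).map (BilinearExtension.gen form1)).prod := by
  revert i j
  decide +kernel

theorem gen_relations2 (i j : Fin 6) : BilinearExtension.gen form2 i * BilinearExtension.gen form2 j =
    ((table2 i j).map (BilinearExtension.gen form2)).prod := by
  revert i j
  decide +kernel

theorem gen_relations3 (i j : Fin 6) : BilinearExtension.gen form3 i * BilinearExtension.gen form3 j =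
    ((table3 i j).map (BilinearExtension.gen form3)).prod := by
  revert i j
  decide +kernel

theorem gen_relations4 (i j : Fin 6) : BilinearExtension.gen form4 i * BilinearExtension.gen form4 j =
    ((table4 i j).map (BilinearExtension.gen form4)).prod := by
  revert i j
  decide +kernel

theorem exists_surjective1 : ∃ f : G1 →* BilinearExtension form1, Function.Surjective f :=
  ⟨_, surjective_lift_gen gen_relations1 (by decide +kernel)⟩

theorem exists_surjective2 : ∃ f : G2 →* BilinearExtension form2, Function.Surjective f :=
  ⟨_, surjective_lift_gen gen_relations2 (by decide +kernel)⟩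

/-- The upper bound from the presentation and the lower bound from the model meet at 64. -/
theorem mulEquiv_of_surjective_of_card_le {G M : Type} [Group G] [Group M] (f : G →* M)
    (hf : Function.Surjective f) (hM : Nat.card M = 64) (hG : ENat.card G ≤ 64) :
    Function.Bijective f := by
  have hfin : Finite G := by
    rw [← ENat.card_lt_top]
    exact hG.trans_lt (ENat.natCast_lt_top 64)
  have h1 : Nat.card G ≤ 64 := by
    rw [ENat.card_eq_coe_natCard] at hG
    exact_mod_cast hG
  exact (Nat.bijective_iff_surjective_and_card f).2
    ⟨hf, le_antisymm (h1.trans hM.ge) (Nat.card_le_card_of_surjective f hf)⟩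

theorem bijective_lift_gen3 : Function.Bijective (TableGroup.lift _ gen_relations3) :=
  mulEquiv_of_surjective_of_card_le _ (surjective_lift_gen gen_relations3 (by decide +kernel))
    (BilinearExtension.card_eq _) (TableGroup.card_le _ (by decide) (by decide))

theorem bijective_lift_gen4 : Function.Bijective (TableGroup.lift _ gen_relations4) :=
  mulEquiv_of_surjective_of_card_le _ (surjective_lift_gen gen_relations4 (by decide +kernel))
    (BilinearExtension.card_eq _) (TableGroup.card_le _ (by decide) (by decide))

/-- `G3` as a central extension. -/
def equiv3 : G3 ≃* BilinearExtension form3 :=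
  MulEquiv.ofBijective _ bijective_lift_gen3

/-- `G4` as a central extension. -/
def equiv4 : G4 ≃* BilinearExtension form4 :=
  MulEquiv.ofBijective _ bijective_lift_gen4

theorem card_G3 : Nat.card G3 = 64 :=
  (Nat.card_congr equiv3.toEquiv).trans (BilinearExtension.card_eq _)

theorem card_G4 : Nat.card G4 = 64 :=
  (Nat.card_congr equiv4.toEquiv).trans (BilinearExtension.card_eq _)

theorem card_sq_eq_one_congr {G H : Type} [Group G] [Group H] (e : G ≃* H) :
    Nat.card {x : G // x * x = 1} = Nat.card {x : H // x * x = 1} :=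
  Nat.card_congr (e.toEquiv.subtypeEquiv fun x => by
    change x * x = 1 ↔ e x * e x = 1
    rw [← map_mul, map_eq_one_iff e e.injective])

theorem card_sq_eq_one1 : Nat.card {x : BilinearExtension form1 // x * x = 1} = 20 := by
  rw [Nat.card_eq_fintype_card]
  decide +kernel

theorem card_sq_eq_one2 : Nat.card {x : BilinearExtension form2 // x * x = 1} = 20 := by
  rw [Nat.card_eq_fintype_card]
  decide +kernel

theorem card_sq_eq_one3 : Nat.card {x : BilinearExtension form3 // x * x = 1} = 32 := by
  rw [Nat.card_eq_fintype_card]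
  decide +kernel

theorem card_sq_eq_one4 : Nat.card {x : BilinearExtension form4 // x * x = 1} = 32 := by
  rw [Nat.card_eq_fintype_card]
  decide +kernel

theorem card_sq_eq_one_G3 : Nat.card {x : G3 // x * x = 1} = 32 :=
  (card_sq_eq_one_congr equiv3).trans card_sq_eq_one3

theorem card_sq_eq_one_G4 : Nat.card {x : G4 // x * x = 1} = 32 :=
  (card_sq_eq_one_congr equiv4).trans card_sq_eq_one4

/-- An isomorphism from G followed by the surjection would be bijective, as both ends have order 64.
Thus `G1` and `G2` only need to surject onto their models, and their own orders are never computed.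
-/
theorem isEmpty_mulEquiv_of_surjective {G K M : Type} [Group G] [Group K] [Group M] (f : K →* M)
    (hf : Function.Surjective f) (hM : Nat.card M = 64) (hG : Nat.card G = 64)
    (h : Nat.card {x : G // x * x = 1} ≠ Nat.card {x : M // x * x = 1}) : IsEmpty (G ≃* K) := by
  refine ⟨fun e => h ?_⟩
  have : Finite G := Nat.finite_of_card_ne_zero (by omega)
  have hb : Function.Bijective (f.comp e.toMonoidHom) :=
    (Nat.bijective_iff_surjective_and_card _).2 ⟨hf.comp e.surjective, hG.trans hM.symm⟩
  exact card_sq_eq_one_congr (MulEquiv.ofBijective _ hb)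

theorem BilinearExtension.mul_comm_iff (b : Fin 4 → Fin 4 → Fin 2 → ZMod 2)
    (x y : BilinearExtension b) : x * y = y * x ↔ form b x.1 y.1 = form b y.1 x.1 := by
  have h : x * y = y * x ↔ x.1 + y.1 = y.1 + x.1 ∧
    x.2 + y.2 + form b x.1 y.1 = y.2 + x.2 + form b y.1 x.1 := Prod.ext_iff
  rw [h, add_comm x.1, add_comm x.2]
  simp

theorem BilinearExtension.mul_self_eq_one_iff (b : Fin 4 → Fin 4 → Fin 2 → ZMod 2)
    (x : BilinearExtension b) : x * x = 1 ↔ form b x.1 x.1 = 0 := by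
  have h1 : x.1 + x.1 = 0 := funext fun i => CharTwo.add_self_eq_zero _
  have h2 : x.2 + x.2 = 0 := funext fun i => CharTwo.add_self_eq_zero _
  rw [mul_def, h1, h2, zero_add]
  exact ⟨fun h => congrArg Prod.snd h, fun h => Prod.ext rfl h⟩

/-- Commuting depends only on the 𝔽₂⁴ components; the factor 4 counts the central 𝔽₂². -/
theorem BilinearExtension.card_centralizer (b : Fin 4 → Fin 4 → Fin 2 → ZMod 2)
    (x : BilinearExtension b) : Nat.card {y // x * y = y * x} =
      Fintype.card {v // form b x.1 v = form b v x.1} * 4 := by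
  rw [Nat.card_congr ((Equiv.subtypeEquivRight (mul_comm_iff b x)).trans
    (Equiv.prodSubtypeFstEquivSubtypeProd (p := fun v => form b x.1 v = form b v x.1))),
    Nat.card_prod, Nat.card_eq_fintype_card, Nat.card_eq_fintype_card]
  simp

open BilinearExtension in
theorem card_centralizer3 (x : BilinearExtension form3) (hx : x * x ≠ 1) :
    Nat.card {y // x * y = y * x} = 16 := by
  have h : ∀ v, form form3 v v ≠ 0 →
      Fintype.card {w // form form3 v w = form form3 w v} = 4 := by
    decide +kernel
  rw [card_centralizer, h x.1 (mt (mul_self_eq_one_iff _ x).2 hx)]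

open BilinearExtension in
theorem exists_card_centralizer4 : ∃ x : BilinearExtension form4, x * x ≠ 1 ∧
    Nat.card {y // x * y = y * x} = 32 := by
  have h : ∃ v, form form4 v v ≠ 0 ∧
      Fintype.card {w // form form4 v w = form form4 w v} = 8 := by
    decide +kernel
  obtain ⟨v, hv, hc⟩ := h
  exact ⟨(show BilinearExtension form4 from (v, 0)), mt (mul_self_eq_one_iff _ _).1 hv,
    (card_centralizer _ _).trans (congrArg (· * 4) hc)⟩

/-- The order lists agree, so a finer invariant is needed: the centralizer orders of the elements
with nontrivial square. -/
theorem isEmpty_G3_mulEquiv_G4 : IsEmpty (G3 ≃* G4) := by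
  refine ⟨fun e => ?_⟩
  let e' : BilinearExtension form4 ≃* BilinearExtension form3 :=
    (equiv4.symm.trans e.symm).trans equiv3
  obtain ⟨x, hx, hc⟩ := exists_card_centralizer4
  have h := card_centralizer3 (e' x) fun h => hx <| by
    rwa [← map_mul, map_eq_one_iff e' e'.injective] at h
  have h' : Nat.card {y // x * y = y * x} = Nat.card {y // e' x * y = y * e' x} :=
    Nat.card_congr (e'.toEquiv.subtypeEquiv fun y => by
      change x * y = y * x ↔ e' x * e' y = e' y * e' x
      rw [← map_mul, ← map_mul, e'.injective.eq_iff])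
  omega

theorem orderList_of_exponent_four {G : Type} [Group G] (hG : Nat.card G = 64)
    (h2 : Nat.card {x : G // x * x = 1} = 32) (h4 : ∀ x : G, x ^ 4 = 1) :
    orderList G = [1, 31, 32, 0, 0, 0, 0] := by
  have hfin : Finite G := Nat.finite_of_card_ne_zero (by omega)
  have hdiv : (Nat.card G).divisors.sort (· ≤ ·) = [1, 2, 4, 8, 16, 32, 64] := by
    have h : Nat.divisors 64 = [1, 2, 4, 8, 16, 32, 64].toFinset := by decide +kernel
    rw [hG, h]
    exact (List.toFinset_sort (· ≤ ·) (by decide)).2 (by decide)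
  have c1 : Nat.card {g : G // orderOf g = 1} = 1 := by
    simp [orderOf_eq_one_iff]
  have hle : ∀ g : G, orderOf g ≤ 4 := fun g => orderOf_le_of_pow_eq_one (by norm_num) (h4 g)
  have c0 : ∀ d, 4 < d → Nat.card {g : G // orderOf g = d} = 0 := fun d hd => by
    have : IsEmpty {g : G // orderOf g = d} := ⟨fun g => by have := hle g.1; have := g.2; omega⟩
    exact Nat.card_of_isEmpty
  classical
  have := Fintype.ofFinite G
  have d2 : ∀ g : G, g * g = 1 ↔ orderOf g = 1 ∨ orderOf g = 2 := fun g => by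
    rw [← Nat.dvd_prime Nat.prime_two, orderOf_dvd_iff_pow_eq_one, pow_two]
  -- The order divides 4, so a nontrivial square leaves only order 4; the complement of the 32
  -- solutions of x² = 1 is then counted.
  have d4 : ∀ g : G, ¬ g * g = 1 ↔ orderOf g = 4 := fun g => by
    have h : orderOf g ∣ 2 ^ 2 := orderOf_dvd_iff_pow_eq_one.2 (h4 g)
    obtain ⟨k, hk, hk'⟩ := (Nat.dvd_prime_pow Nat.prime_two).1 h
    rw [d2, hk']
    interval_cases k <;> simp
  have s1 : Nat.card {g : G // orderOf g = 4} = 32 := by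
    have := Fintype.card_subtype_compl (fun g : G => g * g = 1)
    rw [← Nat.card_eq_fintype_card, ← Nat.card_eq_fintype_card, ← Nat.card_eq_fintype_card,
      hG, h2] at this
    rw [← Nat.card_congr (Equiv.subtypeEquivRight d4), this]
  have s2 : Nat.card {g : G // orderOf g = 2} = 31 := by
    have h := Fintype.card_subtype_or_disjoint (fun g : G => orderOf g = 1)
      (fun g : G => orderOf g = 2) (by
        rw [Pi.disjoint_iff]
        intro g
        simp only [Prop.disjoint_iff]
        rintro ⟨h, h'⟩
        omega)
    rw [← Nat.card_eq_fintype_card, ← Nat.card_eq_fintype_card, ← Nat.card_eq_fintype_card, c1,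
      ← Nat.card_congr (Equiv.subtypeEquivRight d2), h2] at h
    omega
  rw [orderList, hdiv]
  simp only [List.map, c1, s1, s2, c0 8 (by norm_num), c0 16 (by norm_num), c0 32 (by norm_num),
    c0 64 (by norm_num)]

theorem pow_four3 (x : BilinearExtension form3) : x ^ 4 = 1 := by
  revert x
  decide +kernel

theorem pow_four4 (x : BilinearExtension form4) : x ^ 4 = 1 := by
  revert x
  decide +kernel

theorem orderList_G3 : orderList G3 = [1, 31, 32, 0, 0, 0, 0] :=
  orderList_of_exponent_four card_G3 card_sq_eq_one_G3 fun x =>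
    equiv3.injective (by rw [map_pow, pow_four3, map_one])

theorem orderList_G4 : orderList G4 = [1, 31, 32, 0, 0, 0, 0] :=
  orderList_of_exponent_four card_G4 card_sq_eq_one_G4 fun x =>
    equiv4.injective (by rw [map_pow, pow_four4, map_one])

end TableGroups

/-! ### Characters of N, the Fourier isomorphism and the bicharacter -/

section Fourier

variable {G : Type} [Group G] {N : Subgroup G}

/-- The characters of a finite abelian group, as complex additive characters. -/
def circleCharEquiv (A : Type*) [CommGroup A] [Finite A] : (A →* Circle) ≃ AddChar (Additive A) ℂ :=
  Equiv.trans (β := AddChar (Additive A) Circle)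
    { toFun := fun σ => ⟨fun n => σ n.toMul, map_one σ, fun m n => map_mul σ m.toMul n.toMul⟩
      invFun := fun χ => ⟨⟨fun n => χ (Additive.ofMul n), χ.map_zero_eq_one⟩,
        fun m n => χ.map_add_eq_mul (Additive.ofMul m) (Additive.ofMul n)⟩
      left_inv := fun _ => rfl
      right_inv := fun _ => rfl }
    AddChar.circleEquivComplex.toEquiv

open Classical in
theorem sum_circleChar_apply {A : Type*} [CommGroup A] [Finite A] [Fintype (A →* Circle)] (a : A) :
    ∑ σ : A →* Circle, (σ a : ℂ) = if a = 1 then (Nat.card A : ℂ) else 0 := by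
  have := Fintype.ofFinite (Additive A)
  have h : ∀ σ : A →* Circle, (σ a : ℂ) = circleCharEquiv A σ (Additive.ofMul a) := fun _ => rfl
  rw [Fintype.sum_equiv (circleCharEquiv A) _ (fun χ => χ (Additive.ofMul a)) h,
    AddChar.sum_apply_eq_ite, ← Nat.card_eq_fintype_card]
  rfl

instance [IsMulCommutative N] [Finite N] : Finite (CharGroup N) :=
  letI : CommGroup N := { (inferInstance : Group N) with mul_comm := mul_comm' }
  Finite.of_equiv _ (circleCharEquiv N).symm

instance [IsMulCommutative N] [Finite N] : Fintype (CharGroup N) := Fintype.ofFinite _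

open Classical in
theorem sum_charGroup_apply [IsMulCommutative N] [Finite N] (n : N) :
    ∑ σ : CharGroup N, (σ n : ℂ) = if n = 1 then (Nat.card N : ℂ) else 0 :=
  letI : CommGroup N := { (inferInstance : Group N) with mul_comm := mul_comm' }
  (sum_circleChar_apply n).trans (by congr)

theorem charIdempotent_eq_sum [Fintype N] (σ : CharGroup N) :
    charIdempotent σ = ∑ n : N, MonoidAlgebra.single (n : G)
      ((Nat.card N : ℂ)⁻¹ * ((σ n)⁻¹ : Circle)) :=
  finsum_eq_sum_of_fintype _

theorem single_mul_charIdempotent [Finite N] (σ : CharGroup N) (n : N) :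
    MonoidAlgebra.single (n : G) 1 * charIdempotent σ = (σ n : ℂ) • charIdempotent σ := by
  have := Fintype.ofFinite N
  rw [charIdempotent_eq_sum, Finset.mul_sum, Finset.smul_sum]
  refine Fintype.sum_equiv (Equiv.mulLeft n) _ _ fun m => ?_
  rw [MonoidAlgebra.single_mul_single, MonoidAlgebra.smul_single, one_mul, Equiv.coe_mulLeft,
    map_mul, mul_inv, Circle.coe_mul, Circle.coe_inv (σ n), smul_eq_mul, mul_left_comm,
    mul_inv_cancel_left₀ (Circle.coe_ne_zero _), Subgroup.coe_mul]

/-- Fourier inversion: after exchanging the sums, orthogonality of characters leaves only the term m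
= n. -/
theorem sum_smul_charIdempotent [IsMulCommutative N] [Finite N] (n : N) :
    ∑ σ : CharGroup N, (σ n : ℂ) • charIdempotent σ = MonoidAlgebra.single (n : G) 1 := by
  classical
  have := Fintype.ofFinite N
  have h : ∀ σ : CharGroup N, (σ n : ℂ) • charIdempotent σ =
      ∑ m : N, MonoidAlgebra.single (m : G) ((Nat.card N : ℂ)⁻¹ * (σ (n * m⁻¹) : ℂ)) := fun σ => by
    rw [charIdempotent_eq_sum, Finset.smul_sum]
    refine Finset.sum_congr rfl fun m _ => ?_
    rw [MonoidAlgebra.smul_single, smul_eq_mul, map_mul, map_inv, Circle.coe_mul, mul_left_comm]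
  have h' : ∀ m : N, ∑ σ : CharGroup N,
      MonoidAlgebra.single (m : G) ((Nat.card N : ℂ)⁻¹ * (σ (n * m⁻¹) : ℂ)) =
        if n = m then MonoidAlgebra.single (m : G) 1 else 0 := fun m => by
    have e := (map_sum (MonoidAlgebra.singleAddHom (R := ℂ) (m : G))
      (fun σ : CharGroup N => (Nat.card N : ℂ)⁻¹ * (σ (n * m⁻¹) : ℂ)) Finset.univ).symm
    refine Eq.trans e ?_
    rw [← Finset.mul_sum, sum_charGroup_apply]
    simp only [mul_inv_eq_one]
    split_ifs
    · rw [inv_mul_cancel₀ (Nat.cast_ne_zero.2 Nat.card_pos.ne')]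
      rfl
    · rw [mul_zero, map_zero]
  simp_rw [h]
  rw [Finset.sum_comm]
  simp_rw [h']
  simp

theorem sum_charIdempotent [IsMulCommutative N] [Finite N] :
    ∑ σ : CharGroup N, charIdempotent σ = (1 : MonoidAlgebra ℂ G) := by
  have h := sum_smul_charIdempotent (1 : N)
  simp only [map_one, Circle.coe_one, one_smul] at h
  exact h

/-- The element of `ℂ[G] ⊗ ℂ[G]` corresponding to the function `(σ, τ) ↦ σ (f τ)`. -/
theorem cocycleElement_apply [IsMulCommutative N] [Finite N] (f : CharGroup N → N) :
    cocycleElement (fun σ τ => σ (f τ)) =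
      ∑ τ : CharGroup N, MonoidAlgebra.single (f τ : G) (1 : ℂ) ⊗ₜ[ℂ] charIdempotent τ := by
  rw [cocycleElement, finsum_eq_sum_of_fintype, Fintype.sum_prod_type_right]
  refine Finset.sum_congr rfl fun τ _ => ?_
  simp only
  rw [← sum_smul_charIdempotent, TensorProduct.sum_tmul]
  rfl

theorem Circle.eq_one_or_eq_neg_one {c : Circle} (h : c * c = 1) : c = 1 ∨ c = -1 := by
  have h' : (c : ℂ) * c = 1 := by rw [← Circle.coe_mul, h, Circle.coe_one]
  exact (mul_self_eq_one_iff.1 h').imp (fun e => Circle.ext e) (fun e => Circle.ext e)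

theorem Circle.neg_one_ne_one : (-1 : Circle) ≠ 1 := fun h => by
  have h' : ((-1 : Circle) : ℂ) = 1 := by rw [h, Circle.coe_one]
  have h'' : ((-1 : Circle) : ℂ) = -1 := rfl
  rw [h''] at h'
  norm_num at h'

theorem char_eq_one_or_eq_neg_one (σ : CharGroup N) {n : N} (hn : n * n = 1) :
    σ n = 1 ∨ σ n = -1 :=
  Circle.eq_one_or_eq_neg_one (by rw [← map_mul, hn, map_one])

open Classical in
/-- `a` if the character `τ` is nontrivial at `z`, and `1` otherwise. -/
def signSelect (z a : N) (τ : CharGroup N) : N := if τ z = 1 then 1 else a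

theorem signSelect_of_eq_one {z a : N} {τ : CharGroup N} (h : τ z = 1) : signSelect z a τ = 1 :=
  if_pos h

theorem signSelect_of_eq_neg_one {z a : N} {τ : CharGroup N} (h : τ z = -1) :
    signSelect z a τ = a :=
  if_neg (h ▸ Circle.neg_one_ne_one)

/-- The selection is multiplicative in the character because τ(z) = ±1 and a² = 1. This is what
makes `signCocycle` a bicharacter. -/
theorem signSelect_mul {z a : N} (hz : z * z = 1) (ha : a * a = 1) (σ τ : CharGroup N) :
    signSelect z a (σ * τ) = signSelect z a σ * signSelect z a τ := by
  rcases char_eq_one_or_eq_neg_one σ hz with h | h <;>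
    rcases char_eq_one_or_eq_neg_one τ hz with h' | h'
  · rw [signSelect_of_eq_one h, signSelect_of_eq_one h', signSelect_of_eq_one, mul_one]
    rw [MonoidHom.mul_apply, h, h', mul_one]
  · rw [signSelect_of_eq_one h, signSelect_of_eq_neg_one h', signSelect_of_eq_neg_one, one_mul]
    rw [MonoidHom.mul_apply, h, h', one_mul]
  · rw [signSelect_of_eq_neg_one h, signSelect_of_eq_one h', signSelect_of_eq_neg_one, mul_one]
    rw [MonoidHom.mul_apply, h, h', mul_one]
  · rw [signSelect_of_eq_neg_one h, signSelect_of_eq_neg_one h', ha, signSelect_of_eq_one]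
    rw [MonoidHom.mul_apply, h, h', neg_mul_neg, one_mul]

/-- The bicharacter `σ(a)` (if `τ(z) = -1`) times `σ(w)` (if `τ(d) = -1`). -/
def signCocycle (a z w d : N) (σ τ : CharGroup N) : Circle :=
  σ (signSelect z a τ * signSelect d w τ)

/-- For any bicharacter both sides of the cocycle identity expand to ω(ρ,σ) ω(ρ,τ) ω(σ,τ). -/
theorem isTwoCocycle_signCocycle [IsMulCommutative N] {a z w d : N} (ha : a * a = 1)
    (hz : z * z = 1) (hw : w * w = 1) (hd : d * d = 1) :
    IsTwoCocycle (signCocycle a z w d) := by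
  intro ρ σ τ
  simp only [signCocycle, signSelect_mul hz ha, signSelect_mul hd hw, map_mul, MonoidHom.mul_apply]
  simp only [mul_comm, mul_left_comm]

theorem signCocycle_inv {a z w d : N} (ha : a * a = 1) (hw : w * w = 1) (σ τ : CharGroup N) :
    (signCocycle a z w d σ τ)⁻¹ = signCocycle a z w d σ τ := by
  have h : ∀ {z a : N}, a * a = 1 → σ (signSelect z a τ) * σ (signSelect z a τ) = 1 := by
    intro z a ha
    rw [← map_mul, signSelect]
    split_ifs
    · rw [mul_one, map_one]
    · rw [ha, map_one]
  rw [inv_eq_iff_mul_eq_one, signCocycle, map_mul, mul_mul_mul_comm, h ha, h hw, mul_one]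

/-- On the idempotent of τ, z acts by the scalar τ(z) = ±1, and the controlled sign collapses to 1
or to a. -/
theorem controlledSign_mul_tmul_charIdempotent [Finite N] (a : N) {z : N} (hz : z * z = 1)
    (x : MonoidAlgebra ℂ G) (τ : CharGroup N) :
    controlledSign (pairHom ((a : G), 1)) (pairHom (1, (z : G))) * (x ⊗ₜ charIdempotent τ) =
      (MonoidAlgebra.single (signSelect z a τ : G) 1 * x) ⊗ₜ charIdempotent τ := by
  have e1 : (MonoidAlgebra.single (1 : G) (1 : ℂ)) = 1 := rfl
  rw [controlledSign, pairHom_apply, pairHom_apply, e1, smul_mul_assoc, add_mul, add_mul, add_mul,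
    smul_mul_assoc, mul_assoc, Algebra.TensorProduct.tmul_mul_tmul,
    Algebra.TensorProduct.tmul_mul_tmul, one_mul, one_mul, one_mul,
    single_mul_charIdempotent, Algebra.TensorProduct.tmul_mul_tmul, one_mul,
    TensorProduct.tmul_smul, TensorProduct.tmul_smul]
  rcases char_eq_one_or_eq_neg_one τ hz with h | h
  · rw [signSelect_of_eq_one h, h, Circle.coe_one, Subgroup.coe_one, e1, one_mul]
    module
  · have e2 : ((-1 : Circle) : ℂ) = -1 := rfl
    rw [signSelect_of_eq_neg_one h, h, e2]
    module

/-- The idempotents sum to 1, so the second leg can be decomposed by characters; on each piece the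
two controlled signs reduce to a group element in the first leg. -/
theorem cocycleElement_signCocycle [IsMulCommutative N] [Finite N] {a z w d : N}
    (hz : z * z = 1) (hd : d * d = 1) :
    cocycleElement (signCocycle a z w d) = signElement (a : G) z w d := by
  have h : signElement (a : G) z w d = signElement (a : G) z w d *
      ∑ τ : CharGroup N, (1 : MonoidAlgebra ℂ G) ⊗ₜ[ℂ] charIdempotent τ := by
    rw [← TensorProduct.tmul_sum, sum_charIdempotent, ← Algebra.TensorProduct.one_def, mul_one]
  rw [h, Finset.mul_sum]
  refine (cocycleElement_apply _).trans (Finset.sum_congr rfl fun τ _ => ?_)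
  rw [signElement, mul_assoc, controlledSign_mul_tmul_charIdempotent _ hd,
    controlledSign_mul_tmul_charIdempotent _ hz, mul_one, MonoidAlgebra.single_mul_single, mul_one,
    Subgroup.coe_mul]

end Fourier

/-! ### Phases along a central involution -/

section QuarterPhase

variable {G : Type} [Group G]

/-- The element of `ℂ[G]` which is `1` where the involution `z` is `1`, and `c` where it is
`-1`. -/
def phase (z : G) (c : ℂ) : MonoidAlgebra ℂ G :=
  ((1 + c) / 2) • 1 + ((1 - c) / 2) • MonoidAlgebra.single z 1

theorem phase_one (z : G) : phase z 1 = 1 := by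
  simp [phase]

theorem phase_neg_one (z : G) : phase z (-1) = MonoidAlgebra.single z 1 := by
  norm_num [phase]

theorem phase_mul {z : G} (hz : z * z = 1) (c c' : ℂ) :
    phase z c * phase z c' = phase z (c * c') := by
  have h : (MonoidAlgebra.single z 1 * MonoidAlgebra.single z 1 : MonoidAlgebra ℂ G) = 1 := by
    rw [MonoidAlgebra.single_mul_single, hz, one_mul]
    rfl
  simp only [phase, mul_add, add_mul, smul_mul_smul_comm, one_mul, mul_one, h]
  module

theorem groupStar_phase {z : G} (hz : z * z = 1) (c : ℂ) :
    groupStar (phase z c) = phase z (starRingEnd ℂ c) := by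
  have h : groupStar (1 : MonoidAlgebra ℂ G) = 1 := by
    rw [MonoidAlgebra.one_def, groupStar_single, inv_one, map_one]
  rw [phase, groupStar_add, groupStar_smul, groupStar_smul, h, groupStar_single,
    inv_eq_of_mul_eq_one_left hz]
  simp [phase, map_ofNat]

theorem counit_phase (z : G) (c : ℂ) : Coalgebra.counit (R := ℂ) (phase z c) = 1 := by
  rw [phase, map_add, map_smul, map_smul, Bialgebra.counit_one, MonoidAlgebra.counit_single]
  simp
  ring

theorem commute_phase {z : G} (hz : ∀ g, Commute z g) (c : ℂ) (x : MonoidAlgebra ℂ G) :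
    Commute (phase z c) x := by
  have h : Commute (MonoidAlgebra.single z 1) x := by
    induction x using MonoidAlgebra.induction_linear with
    | zero => exact Commute.zero_right _
    | add x y hx hy => exact hx.add_right hy
    | single g c => simp [Commute, SemiconjBy, MonoidAlgebra.single_mul_single, (hz g).eq]
  exact ((Commute.one_left x).smul_left _).add_left (h.smul_left _)

theorem algHom_phase {H : Type} [Group H] (f : MonoidAlgebra ℂ G →ₐ[ℂ] MonoidAlgebra ℂ H)
    {z : G} {z' : H} (hf : f (MonoidAlgebra.single z 1) = MonoidAlgebra.single z' 1) (c : ℂ) :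
    f (phase z c) = phase z' c := by
  rw [phase, map_add, map_smul, map_smul, map_one, hf, phase]

/-- The coproduct of the phase `i` differs from the tensor square by a controlled sign. -/
theorem comul_phase_I {z : G} (hz : z * z = 1) :
    Coalgebra.comul (R := ℂ) (phase z Complex.I) *
      controlledSign (pairHom (z, 1)) (pairHom (1, z)) = phase z Complex.I ⊗ₜ phase z Complex.I := by
  have h1 : Coalgebra.comul (R := ℂ) (phase z Complex.I) =
      ((1 + Complex.I) / 2) • 1 + ((1 - Complex.I) / 2) • pairHom (z, z) := by
    rw [phase, map_add, map_smul, map_smul, Bialgebra.comul_one, MonoidAlgebra.comul_single]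
    simp [pairHom_apply]
  have h2 : phase z Complex.I ⊗ₜ[ℂ] phase z Complex.I =
      (((1 + Complex.I) / 2) • 1 + ((1 - Complex.I) / 2) • pairHom (z, 1)) *
        (((1 + Complex.I) / 2) • 1 + ((1 - Complex.I) / 2) • pairHom (1, z)) := by
    have e1 : (MonoidAlgebra.single (1 : G) (1 : ℂ)) = 1 := rfl
    rw [pairHom_apply, pairHom_apply, e1, Algebra.TensorProduct.one_def, ← TensorProduct.tmul_smul,
      ← TensorProduct.tmul_smul ((1 - Complex.I) / 2) (1 : MonoidAlgebra ℂ G)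
        (MonoidAlgebra.single z (1 : ℂ)), ← TensorProduct.tmul_add,
      TensorProduct.tmul_smul, TensorProduct.smul_tmul', TensorProduct.smul_tmul',
      ← TensorProduct.add_tmul, Algebra.TensorProduct.tmul_mul_tmul, one_mul, mul_one]
    rfl
  have p : ∀ x y x' y' : G, pairHom (x, y) * pairHom (x', y') = pairHom (x * x', y * y') :=
    fun x y x' y' => (map_mul pairHom (x, y) (x', y')).symm
  have p1 : pairHom ((1 : G), (1 : G)) = 1 := map_one pairHom
  rw [h1, h2, controlledSign]
  simp only [mul_add, add_mul, mul_smul_comm, smul_mul_assoc, one_mul, mul_one, p, hz, smul_add,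
    smul_smul, p1]
  -- What remains is a comparison of coefficients of group-like elements. Conceptually, where both
  -- legs have z = −1 the identity reads 1 · (−1) = i · i; elsewhere the sign is 1 and the phases
  -- agree.
  have i2 := Complex.I_mul_I
  match_scalars
  · linear_combination (-1 / 4) * i2
  · linear_combination (-1 / 4) * i2
  · linear_combination (1 / 4) * i2
  · linear_combination (1 / 4) * i2

end QuarterPhase

/-! ### Mutually inverse homomorphisms between the groups and the group algebras -/

theorem TableGroup.induction {t : Fin 6 → Fin 6 → List (Fin 6)} {p : TableGroup t → Prop}
    (one : p 1) (of : ∀ i, p (.of i)) (mul : ∀ x y, p x → p y → p (x * y))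
    (inv : ∀ x, p x → p x⁻¹) (x : TableGroup t) : p x := by
  have hx : x ∈ Subgroup.closure (Set.range PresentedGroup.of) := by
    rw [PresentedGroup.closure_range_of]
    exact Subgroup.mem_top x
  induction hx using Subgroup.closure_induction with
  | mem x hx =>
    obtain ⟨i, rfl⟩ := hx
    exact of i
  | one => exact one
  | mul x y _ _ hx hy => exact mul x y hx hy
  | inv x _ hx => exact inv x hx

theorem TableGroup.monoidHom_ext {t : Fin 6 → Fin 6 → List (Fin 6)} {M : Type*} [Monoid M]
    {f g : TableGroup t →* M} (h : ∀ i, f (.of i) = g (.of i)) : f = g :=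
  MonoidHom.eq_of_eqOn_dense (PresentedGroup.closure_range_of _) (by
    rintro _ ⟨i, rfl⟩
    exact h i)

section Relations

variable {E : Type*} [Group E]

/-- Multiplying the second generator of `G3` by a central square root of the fifth one gives the
relations of `G4`. -/
theorem relations4_of_relations3 (u : Fin 6 → E) (hu : ∀ i j, u i * u j = ((table3 i j).map u).prod)
    (x : E) (hx : ∀ y, Commute x y) (hx2 : x * x = u 4) (i j : Fin 6) :
    Function.update u 1 (x * u 1) i * Function.update u 1 (x * u 1) j =
      ((table4 i j).map (Function.update u 1 (x * u 1))).prod := by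
  have h := hu i j
  have hx' : ∀ y z, y * (x * z) = x * (y * z) := fun y z => ((hx y).left_comm z).symm
  revert h
  -- The central x moves to the front in all 36 relations. It occurs equally often on both sides,
  -- except in the square of the second generator, where x² = f₅ appears.
  fin_cases i <;> fin_cases j <;> intro h <;>
    simp [table3, table4, Function.update, mul_assoc] at h ⊢ <;>
    simp [h, hx', hx2]

/-- The same modification undoes itself at the level of relations: x² = f₅ now meets f₂² = f₅, and
f₅² = 1. -/
theorem relations3_of_relations4 (u : Fin 6 → E) (hu : ∀ i j, u i * u j = ((table4 i j).map u).prod)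
    (x : E) (hx : ∀ y, Commute x y) (hx2 : x * x = u 4) (i j : Fin 6) :
    Function.update u 1 (x * u 1) i * Function.update u 1 (x * u 1) j =
      ((table3 i j).map (Function.update u 1 (x * u 1))).prod := by
  have h := hu i j
  have h4 : u 4 * u 4 = 1 := hu 4 4
  have hx' : ∀ y z, y * (x * z) = x * (y * z) := fun y z => ((hx y).left_comm z).symm
  revert h
  fin_cases i <;> fin_cases j <;> intro h <;>
    simp [table3, table4, Function.update, mul_assoc] at h ⊢ <;>
    simp [h, h4, hx', hx2, ← mul_assoc x x]

end Relations

theorem TableGroup.commute_of {t : Fin 6 → Fin 6 → List (Fin 6)} {i j : Fin 6}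
    (h : t i j = t j i) : Commute (.of i : TableGroup t) (.of j) := by
  rw [Commute, SemiconjBy, TableGroup.of_mul_of, TableGroup.of_mul_of, h]

theorem TableGroup.of_mul_self {t : Fin 6 → Fin 6 → List (Fin 6)} {i : Fin 6}
    (h : t i i = []) : (.of i * .of i : TableGroup t) = 1 := by
  rw [TableGroup.of_mul_of, h]
  rfl

theorem TableGroup.commute_of_forall {t : Fin 6 → Fin 6 → List (Fin 6)} {i : Fin 6}
    (h : ∀ j, t i j = t j i) (x : TableGroup t) : Commute (.of i : TableGroup t) x := by
  induction x using TableGroup.induction with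
  | one => exact Commute.one_right _
  | of j => exact TableGroup.commute_of (h j)
  | mul x y hx hy => exact hx.mul_right hy
  | inv x hx => exact hx.inv_right

section Units

variable {G : Type} [Group G]

/-- Group elements as units of the group algebra. -/
def unitOf : G →* (MonoidAlgebra ℂ G)ˣ := (MonoidAlgebra.of ℂ G).toHomUnits

theorem coe_unitOf (g : G) : (unitOf g : MonoidAlgebra ℂ G) = MonoidAlgebra.single g 1 := rfl

/-- The phase of a nonzero complex number, as a unit. -/
def phaseUnit {z : G} (hz : z * z = 1) {c c' : ℂ} (hc : c * c' = 1) : (MonoidAlgebra ℂ G)ˣ where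
  val := phase z c
  inv := phase z c'
  val_inv := by rw [phase_mul hz, hc, phase_one]
  inv_val := by rw [phase_mul hz, mul_comm, hc, phase_one]

end Units

theorem I_mul_neg_I : Complex.I * -Complex.I = 1 := by simp

theorem neg_I_mul_I : -Complex.I * Complex.I = 1 := by simp

theorem phaseUnit_mul_self {G : Type} [Group G] {z : G} (hz : z * z = 1) {c c' : ℂ}
    (hc : c * c' = 1) (hc' : c * c = -1) :
    phaseUnit hz hc * phaseUnit hz hc = unitOf z := Units.ext (by
  rw [Units.val_mul, coe_unitOf]
  exact (phase_mul hz c c).trans (by rw [hc', phase_neg_one]))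

theorem commute_phaseUnit {G : Type} [Group G] {z : G} (hz : z * z = 1) {c c' : ℂ}
    (hc : c * c' = 1) (hz' : ∀ g, Commute z g) (y : (MonoidAlgebra ℂ G)ˣ) :
    Commute (phaseUnit hz hc) y :=
  Units.ext (commute_phase hz' c (y : MonoidAlgebra ℂ G))

theorem unitOf_relations (t : Fin 6 → Fin 6 → List (Fin 6)) (i j : Fin 6) :
    (unitOf (.of i : TableGroup t)) * unitOf (.of j) =
      ((t i j).map fun k => unitOf (.of k : TableGroup t)).prod := by
  rw [← map_mul, TableGroup.of_mul_of, map_list_prod, List.map_map]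
  rfl

theorem center3 (x : G3) : Commute (.of 4 : G3) x :=
  TableGroup.commute_of_forall (by decide) x

theorem center4 (x : G4) : Commute (.of 4 : G4) x :=
  TableGroup.commute_of_forall (by decide) x

theorem sq3 : (.of 4 * .of 4 : G3) = 1 := TableGroup.of_mul_self rfl

theorem sq4 : (.of 4 * .of 4 : G4) = 1 := TableGroup.of_mul_self rfl

/-- The images of the generators of `G4` in `ℂ[G3]`. -/
def twistGen : Fin 6 → (MonoidAlgebra ℂ G3)ˣ :=
  Function.update (fun k => unitOf (.of k)) 1 (phaseUnit sq3 I_mul_neg_I * unitOf (.of 1))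

/-- The images of the generators of `G3` in `ℂ[G4]`. -/
def untwistGen : Fin 6 → (MonoidAlgebra ℂ G4)ˣ :=
  Function.update (fun k => unitOf (.of k)) 1 (phaseUnit sq4 neg_I_mul_I * unitOf (.of 1))

/-- The phase i along f₅ is a central square root of f₅, since its square is the phase −1, which is
f₅ itself. -/
theorem twistGen_relations (i j : Fin 6) :
    twistGen i * twistGen j = ((table4 i j).map twistGen).prod :=
  relations4_of_relations3 _ (unitOf_relations _) _
    (commute_phaseUnit sq3 I_mul_neg_I center3) (phaseUnit_mul_self _ _ Complex.I_mul_I) i j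

theorem untwistGen_relations (i j : Fin 6) :
    untwistGen i * untwistGen j = ((table3 i j).map untwistGen).prod :=
  relations3_of_relations4 _ (unitOf_relations _) _
    (commute_phaseUnit sq4 neg_I_mul_I center4) (phaseUnit_mul_self _ _ (by simp)) i j

/-- The homomorphism from `G4` to `ℂ[G3]`. -/
def twist : G4 →* MonoidAlgebra ℂ G3 :=
  (Units.coeHom _).comp (TableGroup.lift twistGen twistGen_relations)

/-- The homomorphism from `G3` to `ℂ[G4]`. -/
def untwist : G3 →* MonoidAlgebra ℂ G4 :=
  (Units.coeHom _).comp (TableGroup.lift untwistGen untwistGen_relations)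

theorem twist_of {i : Fin 6} (hi : i ≠ 1) :
    twist (.of i) = MonoidAlgebra.single (.of i) 1 := by
  rw [twist, MonoidHom.comp_apply, TableGroup.lift_of, twistGen, Function.update_of_ne hi]
  rfl

theorem twist_of_one :
    twist (.of 1) = phase (.of 4) Complex.I * MonoidAlgebra.single (.of 1) 1 := by
  rw [twist, MonoidHom.comp_apply, TableGroup.lift_of, twistGen, Function.update_self]
  rfl

theorem untwist_of {i : Fin 6} (hi : i ≠ 1) :
    untwist (.of i) = MonoidAlgebra.single (.of i) 1 := by
  rw [untwist, MonoidHom.comp_apply, TableGroup.lift_of, untwistGen, Function.update_of_ne hi]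
  rfl

theorem untwist_of_one :
    untwist (.of 1) = phase (.of 4) (-Complex.I) * MonoidAlgebra.single (.of 1) 1 := by
  rw [untwist, MonoidHom.comp_apply, TableGroup.lift_of, untwistGen, Function.update_self]
  rfl

theorem groupStar_one {G : Type} [Group G] : groupStar (1 : MonoidAlgebra ℂ G) = 1 := by
  rw [MonoidAlgebra.one_def, groupStar_single, inv_one, map_one]

theorem groupStar_groupStar {G : Type} [Group G] (a : MonoidAlgebra ℂ G) :
    groupStar (groupStar a) = a := by
  induction a using MonoidAlgebra.induction_linear with
  | zero => simp [groupStar_zero]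
  | add a b ha hb => rw [groupStar_add, groupStar_add, ha, hb]
  | single g c => simp [groupStar_single]

/-- Unitarity of a homomorphism to a group algebra can be checked on generators. -/
theorem groupStar_map_of_generators {t : Fin 6 → Fin 6 → List (Fin 6)} {G : Type} [Group G]
    (f : TableGroup t →* MonoidAlgebra ℂ G)
    (h : ∀ i, groupStar (f (.of i)) * f (.of i) = 1) (x : TableGroup t) :
    groupStar (f x) = f x⁻¹ := by
  have key : groupStar (f x) * f x = 1 := by
    induction x using TableGroup.induction with
    | one => rw [map_one, groupStar_one, mul_one]
    | of i => exact h i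
    | mul x y hx hy =>
      rw [map_mul, groupStar_mul, mul_assoc, ← mul_assoc (groupStar (f x)), hx, one_mul, hy]
    | inv x hx =>
      -- The left inverse supplied by induction and the right inverse f x⁻¹ coincide.
      have e : f x⁻¹ = groupStar (f x) := by
        rw [← one_mul (f x⁻¹), ← hx, mul_assoc, ← map_mul, mul_inv_cancel, map_one, mul_one]
      rw [e, groupStar_groupStar, ← e, ← map_mul, mul_inv_cancel, map_one]
  rw [← mul_one (groupStar (f x)), ← map_one f, ← mul_inv_cancel x, map_mul, ← mul_assoc, key,
    one_mul]

theorem groupStar_single_mul_self {G : Type} [Group G] (g : G) :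
    groupStar (MonoidAlgebra.single g 1) * MonoidAlgebra.single g (1 : ℂ) = 1 := by
  rw [groupStar_single, MonoidAlgebra.single_mul_single, inv_mul_cancel, map_one, one_mul]
  rfl

theorem groupStar_phase_mul_single {G : Type} [Group G] {z : G} (hz : z * z = 1) (g : G) {c : ℂ}
    (hc : starRingEnd ℂ c * c = 1) :
    groupStar (phase z c * MonoidAlgebra.single g 1) * (phase z c * MonoidAlgebra.single g 1) =
      1 := by
  rw [groupStar_mul, mul_assoc, ← mul_assoc (groupStar (phase z c)), groupStar_phase hz,
    phase_mul hz, hc, phase_one, one_mul, groupStar_single_mul_self]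

theorem groupStar_twist (h : G4) : groupStar (twist h) = twist h⁻¹ := by
  refine groupStar_map_of_generators twist (fun i => ?_) h
  by_cases hi : i = 1
  · subst hi
    rw [twist_of_one]
    exact groupStar_phase_mul_single sq3 _ (by simp)
  · rw [twist_of hi]
    exact groupStar_single_mul_self _

theorem groupStar_untwist (g : G3) : groupStar (untwist g) = untwist g⁻¹ := by
  refine groupStar_map_of_generators untwist (fun i => ?_) g
  by_cases hi : i = 1
  · subst hi
    rw [untwist_of_one]
    exact groupStar_phase_mul_single sq4 _ (by simp)
  · rw [untwist_of hi]
    exact groupStar_single_mul_self _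

/-- The extension of `twist` to `ℂ[G4]`. -/
def twistAlg : MonoidAlgebra ℂ G4 →ₐ[ℂ] MonoidAlgebra ℂ G3 := MonoidAlgebra.lift ℂ _ G4 twist

/-- The extension of `untwist` to `ℂ[G3]`. -/
def untwistAlg : MonoidAlgebra ℂ G3 →ₐ[ℂ] MonoidAlgebra ℂ G4 := MonoidAlgebra.lift ℂ _ G3 untwist

theorem twistAlg_single (h : G4) : twistAlg (MonoidAlgebra.single h 1) = twist h := by
  rw [twistAlg, MonoidAlgebra.lift_single, one_smul]

theorem untwistAlg_single (g : G3) : untwistAlg (MonoidAlgebra.single g 1) = untwist g := by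
  rw [untwistAlg, MonoidAlgebra.lift_single, one_smul]

/-- On generators only f₂ needs an argument: f₅ is fixed, and the phases −i and i along it cancel.
-/
theorem twistAlg_untwist (g : G3) : twistAlg (untwist g) = MonoidAlgebra.single g 1 := by
  suffices h : (twistAlg : MonoidAlgebra ℂ G4 →* MonoidAlgebra ℂ G3).comp untwist =
      MonoidAlgebra.of ℂ G3 from DFunLike.congr_fun h g
  refine TableGroup.monoidHom_ext fun i => ?_
  change twistAlg (untwist (.of i)) = MonoidAlgebra.single (.of i) 1
  have h : ∀ {i : Fin 6}, i ≠ 1 → twistAlg (MonoidAlgebra.single (.of i) 1) =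
      MonoidAlgebra.single (.of i) 1 := fun hi => (twistAlg_single _).trans (twist_of hi)
  by_cases hi : i = 1
  · subst hi
    rw [untwist_of_one, map_mul, twistAlg_single, twist_of_one,
      algHom_phase twistAlg (h (by decide)), ← mul_assoc, phase_mul sq3, neg_I_mul_I,
      phase_one, one_mul]
  · rw [untwist_of hi, h hi]

theorem untwistAlg_twist (h : G4) : untwistAlg (twist h) = MonoidAlgebra.single h 1 := by
  suffices h' : (untwistAlg : MonoidAlgebra ℂ G3 →* MonoidAlgebra ℂ G4).comp twist =
      MonoidAlgebra.of ℂ G4 from DFunLike.congr_fun h' h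
  refine TableGroup.monoidHom_ext fun i => ?_
  change untwistAlg (twist (.of i)) = MonoidAlgebra.single (.of i) 1
  have h : ∀ {i : Fin 6}, i ≠ 1 → untwistAlg (MonoidAlgebra.single (.of i) 1) =
      MonoidAlgebra.single (.of i) 1 := fun hi => (untwistAlg_single _).trans (untwist_of hi)
  by_cases hi : i = 1
  · subst hi
    rw [twist_of_one, map_mul, untwistAlg_single, untwist_of_one,
      algHom_phase untwistAlg (h (by decide)), ← mul_assoc, phase_mul sq4, I_mul_neg_I,
      phase_one, one_mul]
  · rw [twist_of hi, h hi]

/-- The isomorphism `ℂ[G4] ≃ ℂ[G3]`. -/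
def twistEquiv : MonoidAlgebra ℂ G4 ≃ₐ[ℂ] MonoidAlgebra ℂ G3 :=
  AlgEquiv.ofAlgHom twistAlg untwistAlg
    (MonoidAlgebra.algHom_ext (fun g => by
      rw [AlgHom.comp_apply, untwistAlg_single, twistAlg_untwist]; rfl) (by ext))
    (MonoidAlgebra.algHom_ext (fun h => by
      rw [AlgHom.comp_apply, twistAlg_single, untwistAlg_twist]; rfl) (by ext))

theorem counit_twist (h : G4) : Coalgebra.counit (R := ℂ) (twist h) = 1 := by
  suffices h' : ((Bialgebra.counitAlgHom ℂ (MonoidAlgebra ℂ G3) : MonoidAlgebra ℂ G3 →* ℂ)).comp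
      twist = 1 from DFunLike.congr_fun h' h
  refine TableGroup.monoidHom_ext fun i => ?_
  change Bialgebra.counitAlgHom ℂ (MonoidAlgebra ℂ G3) (twist (.of i)) = 1
  by_cases hi : i = 1
  · subst hi
    rw [twist_of_one, map_mul, Bialgebra.counitAlgHom_apply, Bialgebra.counitAlgHom_apply,
      counit_phase, MonoidAlgebra.counit_single]
    simp
  · rw [twist_of hi, Bialgebra.counitAlgHom_apply, MonoidAlgebra.counit_single]
    simp

/-! ### The normal subgroup N of `G3` and its invariant non-degenerate cocycle -/

theorem equiv3_of (i : Fin 6) : equiv3 (.of i) = BilinearExtension.gen form3 i :=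
  TableGroup.lift_of _ gen_relations3 i

/-- The embedding of `C₂⁴` into the extension as the elements over the last two coordinates of
`𝔽₂⁴`. -/
def fourGroupHom : (Fin 4 → Multiplicative (ZMod 2)) →* BilinearExtension form3 where
  toFun v := (![0, 0, (v 0).toAdd, (v 1).toAdd], ![(v 2).toAdd, (v 3).toAdd])
  map_one' := by
    change _ = ((0, 0) : (Fin 4 → ZMod 2) × (Fin 2 → ZMod 2))
    decide
  map_mul' v w := by
    refine Prod.ext ?_ ?_
    · change _ = ![0, 0, _, _] + ![0, 0, _, _]
      simp
    · change _ = ![_, _] + ![_, _] + BilinearExtension.form form3 ![0, 0, _, _] ![0, 0, _, _]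
      ext k
      fin_cases k <;> simp [BilinearExtension.form, Fin.sum_univ_four, form3]

theorem fourGroupHom_injective : Function.Injective fourGroupHom := by decide +kernel

/-- The subgroup of `G3` generated by the last four generators. -/
def twistSubgroup : Subgroup G3 := (equiv3.symm.toMonoidHom.comp fourGroupHom).range

/-- The isomorphism of `C₂⁴` with the subgroup generated by the last four generators. -/
def twistSubgroupEquiv : (Fin 4 → Multiplicative (ZMod 2)) ≃* twistSubgroup :=
  MonoidHom.ofInjective (f := equiv3.symm.toMonoidHom.comp fourGroupHom)
    (equiv3.symm.injective.comp fourGroupHom_injective)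

theorem equiv3_twistSubgroupEquiv (v : Fin 4 → Multiplicative (ZMod 2)) :
    equiv3 (twistSubgroupEquiv v : G3) = fourGroupHom v :=
  equiv3.apply_symm_apply _

instance : IsMulCommutative twistSubgroup := ⟨⟨fun x y => twistSubgroupEquiv.symm.injective (by
  rw [map_mul, map_mul, mul_comm])⟩⟩

instance : Finite twistSubgroup := Finite.of_equiv _ twistSubgroupEquiv.toEquiv

/-- The image is cut out by vanishing of the first two coordinates of 𝔽₂⁴, which conjugation does
not change because the quotient 𝔽₂⁴ is abelian. -/
theorem conj_fourGroupHom (p : BilinearExtension form3) (v : Fin 4 → Multiplicative (ZMod 2)) :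
    ∃ v', fourGroupHom v' = p * fourGroupHom v * p⁻¹ := by
  have h : ∀ q : BilinearExtension form3, q.1 0 = 0 → q.1 1 = 0 → ∃ v', fourGroupHom v' = q := by
    decide +kernel
  refine h _ ?_ ?_
  · change p.1 0 + 0 + -p.1 0 = 0
    rw [add_zero, add_neg_cancel]
  · change p.1 1 + 0 + -p.1 1 = 0
    rw [add_zero, add_neg_cancel]

instance : twistSubgroup.Normal where
  conj_mem := by
    rintro _ ⟨v, rfl⟩ g
    obtain ⟨v', hv'⟩ := conj_fourGroupHom (equiv3 g) v
    refine ⟨v', equiv3.injective ?_⟩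
    rw [map_mul, map_mul, map_inv]
    change equiv3 (equiv3.symm _) = equiv3 g * equiv3 (equiv3.symm _) * (equiv3 g)⁻¹
    rw [equiv3.apply_symm_apply, equiv3.apply_symm_apply, hv']

/-- The standard basis of the subgroup. -/
def basis (i : Fin 4) : twistSubgroup := twistSubgroupEquiv (Pi.mulSingle i (.ofAdd 1))

theorem coe_basis (i : Fin 4) : (basis i : G3) = .of (![2, 3, 4, 5] i) := by
  refine equiv3.injective ?_
  rw [basis, equiv3_twistSubgroupEquiv, equiv3_of]
  revert i
  decide +kernel

theorem basis_mul_self (i : Fin 4) : basis i * basis i = 1 := by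
  rw [basis, ← map_mul, ← map_one twistSubgroupEquiv]
  congr 1
  revert i
  decide

theorem charGroup_eq_one {σ : CharGroup twistSubgroup} (h : ∀ i, σ (basis i) = 1) : σ = 1 := by
  have e : σ.comp twistSubgroupEquiv.toMonoidHom = 1 := by
    refine MonoidHom.functions_ext _ _ _ fun i x => ?_
    have hx : x = 1 ∨ x = .ofAdd 1 := by
      revert x
      decide
    rcases hx with rfl | rfl
    · rw [Pi.mulSingle_one, map_one, map_one]
    · exact h i
  ext n : 1
  rw [← twistSubgroupEquiv.apply_symm_apply n]
  exact DFunLike.congr_fun e _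

/-- The coordinate characters of the subgroup. -/
def dualBasis (i : Fin 4) : CharGroup twistSubgroup :=
  (ZMod.toCircle (N := 2)).toMonoidHom.comp
    ((Pi.evalMonoidHom _ i).comp twistSubgroupEquiv.symm.toMonoidHom)

theorem dualBasis_basis (i j : Fin 4) : dualBasis i (basis j) =
    ZMod.toCircle ((Pi.mulSingle j (.ofAdd 1) : Fin 4 → Multiplicative (ZMod 2)) i).toAdd := by
  change ZMod.toCircle (Multiplicative.toAdd (twistSubgroupEquiv.symm (basis j) i)) = _
  rw [basis, MulEquiv.symm_apply_apply]

theorem dualBasis_self (i : Fin 4) : dualBasis i (basis i) ≠ 1 := by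
  rw [dualBasis_basis, Pi.mulSingle_eq_same, ← AddChar.map_zero_eq_one (ZMod.toCircle (N := 2))]
  exact fun h => absurd (ZMod.injective_toCircle h) (by decide)

theorem dualBasis_of_ne {i j : Fin 4} (h : i ≠ j) : dualBasis i (basis j) = 1 := by
  rw [dualBasis_basis, Pi.mulSingle_eq_of_ne h]
  exact AddChar.map_zero_eq_one _

/-- The 2-cocycle giving the twist from `G3` to `G4`. -/
def twistCocycle : CharGroup twistSubgroup → CharGroup twistSubgroup → Circle :=
  signCocycle (basis 0) (basis 2) (basis 3) (basis 1)

open Classical in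
/-- `x` if `c` is nontrivial, and `1` otherwise. -/
def signPower (c x : Circle) : Circle := if c = 1 then 1 else x

theorem signPower_one (x : Circle) : signPower 1 x = 1 := if_pos rfl

theorem signPower_of_ne_one {c : Circle} (h : c ≠ 1) (x : Circle) : signPower c x = x := if_neg h

theorem signPower_neg_one (x : Circle) : signPower (-1) x = x :=
  signPower_of_ne_one Circle.neg_one_ne_one x

theorem signPower_right_one (c : Circle) : signPower c 1 = 1 := ite_self 1

theorem twistCocycle_apply (σ τ : CharGroup twistSubgroup) : twistCocycle σ τ =
    signPower (τ (basis 2)) (σ (basis 0)) * signPower (τ (basis 1)) (σ (basis 3)) := by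
  rw [twistCocycle, signCocycle, map_mul, signSelect, signSelect, apply_ite σ, apply_ite σ,
    map_one, signPower, signPower]

theorem isNondegenerateCocycle_twistCocycle : IsNondegenerateCocycle twistCocycle := by
  intro σ h
  have h' : ∀ τ, twistCocycle σ τ = twistCocycle τ σ := fun τ => mul_inv_eq_one.1 (h τ)
  simp only [twistCocycle_apply] at h'
  have hs : ∀ j x, x ≠ 1 → signPower (σ (basis j)) x = 1 → σ (basis j) = 1 := by
    intro j x hx e
    by_contra hne
    exact hx ((signPower_of_ne_one hne x).symm.trans e)
  -- The bicharacter pairs f₃ with f₅ and f₄ with f₆, so testing against the dual character of one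
  -- member of a pair determines σ on the other.
  have h2 := h' (dualBasis 0)
  have h1 := h' (dualBasis 3)
  have h0 := h' (dualBasis 2)
  have h3 := h' (dualBasis 1)
  simp only [ne_eq, Fin.reduceEq, not_false_eq_true, dualBasis_of_ne,
    signPower_of_ne_one (dualBasis_self _), signPower_one, signPower_right_one, mul_one,
    one_mul] at h0 h1 h2 h3
  refine charGroup_eq_one fun i => ?_
  fin_cases i
  · exact h0
  · exact hs 1 _ (dualBasis_self 3) h1.symm
  · exact hs 2 _ (dualBasis_self 0) h2.symm
  · exact h3

theorem conjChar_mul {G : Type} [Group G] {N : Subgroup G} [N.Normal] (x y : G)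
    (σ : CharGroup N) : conjChar (x * y) σ = conjChar y (conjChar x σ) := by
  ext n : 1
  simp [conjChar]

theorem conjChar_one {G : Type} [Group G] {N : Subgroup G} [N.Normal]
    (σ : CharGroup N) : conjChar 1 σ = σ := by
  ext n : 1
  simp [conjChar]

theorem conjChar_map_mul {G : Type} [Group G] {N : Subgroup G} [N.Normal] (x : G)
    (σ τ : CharGroup N) : conjChar x (σ * τ) = conjChar x σ * conjChar x τ := rfl

/-- The invariance of a cocycle can be checked on generators. -/
theorem isInvariantCocycle_of_generators {t : Fin 6 → Fin 6 → List (Fin 6)}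
    {N : Subgroup (TableGroup t)} [N.Normal] {ω : CharGroup N → CharGroup N → Circle}
    (h : ∀ i, CocycleEquiv (fun σ τ => ω (conjChar (.of i) σ) (conjChar (.of i) τ)) ω) :
    IsInvariantCocycle ω := by
  intro g
  induction g using TableGroup.induction with
  | one => exact ⟨1, fun σ τ => by simp [conjChar_one]⟩
  | of i => exact h i
  | mul x y hx hy =>
    obtain ⟨ξ, hξ⟩ := hx
    obtain ⟨η, hη⟩ := hy
    -- The translate by xy is the translate by y evaluated at characters already translated by x,
    -- hence the composed argument of η.
    refine ⟨fun σ => η (conjChar x σ) * ξ σ, fun σ τ => ?_⟩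
    have h1 := hξ σ τ
    have h2 := hη (conjChar x σ) (conjChar x τ)
    simp only [mul_inv_eq_iff_eq_mul] at h1 h2
    simp only [conjChar_mul, conjChar_map_mul, mul_inv_eq_iff_eq_mul]
    rw [h2, h1, mul_inv_rev, mul_mul_mul_comm (η _), mul_mul_mul_comm (η _ * η _)]
    simp only [mul_assoc]
  | inv x hx =>
    obtain ⟨ξ, hξ⟩ := hx
    refine ⟨fun σ => (ξ (conjChar x⁻¹ σ))⁻¹, fun σ τ => ?_⟩
    have h1 := hξ (conjChar x⁻¹ σ) (conjChar x⁻¹ τ)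
    have e : ∀ σ : CharGroup N, conjChar x (conjChar x⁻¹ σ) = σ := fun σ => by
      rw [← conjChar_mul, inv_mul_cancel, conjChar_one]
    simp only [e, ← conjChar_map_mul] at h1
    beta_reduce
    rw [← inv_inj, mul_inv_rev, inv_inv, h1, mul_inv_rev, inv_inv, mul_inv_rev, inv_inv, inv_inv,
      mul_comm (ξ (conjChar x⁻¹ τ)), mul_comm]

theorem conjChar_basis (i : Fin 6) (σ : CharGroup twistSubgroup) (j : Fin 4) (n : twistSubgroup)
    (h : (PresentedGroup.of i : G3) * (basis j : G3) = (n : G3) * PresentedGroup.of i) :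
    conjChar (.of i) σ (basis j) = σ n := by
  rw [conjChar, MonoidHom.comp_apply]
  congr 1
  refine Subtype.ext ?_
  change ((MulAut.conjNormal (PresentedGroup.of i : G3) (basis j) : twistSubgroup) : G3) = n
  rw [MulAut.conjNormal_apply, mul_inv_eq_iff_eq_mul, h]

theorem isInvariantCocycle_twistCocycle : IsInvariantCocycle twistCocycle := by
  refine isInvariantCocycle_of_generators fun i => ?_
  have hs : ∀ (σ : CharGroup twistSubgroup) j, σ (basis j) = 1 ∨ σ (basis j) = -1 := fun σ j =>
    char_eq_one_or_eq_neg_one σ (basis_mul_self j)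
  have hc : ∀ (i : Fin 6) (j : Fin 4) (n : twistSubgroup),
      equiv3 (.of i) * equiv3 (basis j : G3) = equiv3 (n : G3) * equiv3 (.of i) →
      ∀ σ, conjChar (.of i) σ (basis j) = σ n := fun i j n h σ =>
    conjChar_basis i σ j n (equiv3.injective (by rw [map_mul, map_mul, h]))
  simp only [equiv3_of, coe_basis] at hc
  by_cases h0 : i = 0
  · subst h0
    have a0 := hc 0 0 (basis 0 * basis 3) (by
      simp only [Subgroup.coe_mul, map_mul, coe_basis, equiv3_of]; decide +kernel)
    have a1 := hc 0 1 (basis 1 * basis 2) (by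
      simp only [Subgroup.coe_mul, map_mul, coe_basis, equiv3_of]; decide +kernel)
    have a2 := hc 0 2 (basis 2) (by simp only [coe_basis, equiv3_of]; decide +kernel)
    have a3 := hc 0 3 (basis 3) (by simp only [coe_basis, equiv3_of]; decide +kernel)
    -- Here ω is invariant on the nose: f₃ ↦ f₃f₆ and f₄ ↦ f₄f₅ each contribute σ(f₆) when τ(f₅) =
    -- −1, and σ(f₆)² = 1.
    refine ⟨1, fun σ τ => ?_⟩
    simp only [twistCocycle_apply, a0, a1, a2, a3, map_mul]
    rcases hs τ 1 with h1 | h1 <;> rcases hs τ 2 with h2 | h2 <;> rcases hs σ 3 with h3 | h3 <;>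
      simp [h1, h2, h3, signPower_one, signPower_neg_one]
  by_cases h1 : i = 1
  · subst h1
    have a0 := hc 1 0 (basis 0 * basis 2) (by
      simp only [Subgroup.coe_mul, map_mul, coe_basis, equiv3_of]; decide +kernel)
    have a1 := hc 1 1 (basis 1) (by simp only [coe_basis, equiv3_of]; decide +kernel)
    have a2 := hc 1 2 (basis 2) (by simp only [coe_basis, equiv3_of]; decide +kernel)
    have a3 := hc 1 3 (basis 3) (by simp only [coe_basis, equiv3_of]; decide +kernel)
    -- Since f₃ ↦ f₃f₅, the translate gains −1 exactly when σ(f₅) = τ(f₅) = −1. This is the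
    -- coboundary of the function equal to i where σ(f₅) = −1, the Fourier form of the phase i along
    -- f₅.
    let c : Circle := ⟨Complex.I, mem_sphere_zero_iff_norm.2 Complex.norm_I⟩
    have hcc : c * c = -1 := Circle.ext Complex.I_mul_I
    refine ⟨fun σ => signPower (σ (basis 2)) c, fun σ τ => ?_⟩
    simp only [twistCocycle_apply, a0, a1, a2, a3, map_mul, MonoidHom.mul_apply]
    rcases hs τ 1 with h1 | h1 <;> rcases hs τ 2 with h2 | h2 <;> rcases hs σ 2 with h3 | h3 <;>
      simp [h1, h2, h3, signPower_one, signPower_neg_one, hcc]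
  -- The remaining generators lie in the abelian group N and fix all its characters.
  have a : ∀ σ j, conjChar (.of i : G3) σ (basis j) = σ (basis j) := fun σ j =>
    hc i j (basis j) (by
      rw [coe_basis, equiv3_of]
      revert i j
      decide +kernel) σ
  refine ⟨1, fun σ τ => ?_⟩
  simp only [twistCocycle_apply, a]
  simp

/-! ### Conjugating the sign element, and intertwining of coproducts -/

section SemiconjPair

variable {G : Type} [Group G]

theorem comul_single_one (g : G) :
    Coalgebra.comul (R := ℂ) (MonoidAlgebra.single g (1 : ℂ)) = pairHom (g, g) := by
  rw [MonoidAlgebra.comul_single, pairHom_apply]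
  simp

theorem semiconjBy_pairHom {x g g' h h' : G} (hg : SemiconjBy x g g') (hh : SemiconjBy x h h') :
    SemiconjBy (pairHom (x, x)) (pairHom (g, h)) (pairHom (g', h')) :=
  SemiconjBy.map (Prod.ext hg.eq hh.eq : (x, x) * (g, h) = (g', h') * (x, x)) _

/-- Conjugation of a product of two controlled signs. -/
theorem semiconjBy_signElement {x a z w d a' z' w' d' : G} (ha : SemiconjBy x a a')
    (hz : SemiconjBy x z z') (hw : SemiconjBy x w w') (hd : SemiconjBy x d d') :
    SemiconjBy (pairHom (x, x)) (signElement a z w d) (signElement a' z' w' d') :=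
  ((semiconjBy_pairHom ha (.one_right x)).controlledSign
    (semiconjBy_pairHom (.one_right x) hz)).mul_right
  ((semiconjBy_pairHom hw (.one_right x)).controlledSign
    (semiconjBy_pairHom (.one_right x) hd))

theorem controlledSign_pairHom_mul_left (a a' : G) {z : G} (hz : z * z = 1) :
    controlledSign (pairHom (a * a', 1)) (pairHom (1, z)) =
      controlledSign (pairHom (a, 1)) (pairHom (1, z)) *
        controlledSign (pairHom (a', 1)) (pairHom (1, z)) := by
  rw [← controlledSign_mul_left _ (commute_pairHom (.one_right a') (.one_left z))
    (pairHom_mul_self (mul_one 1) hz), ← map_mul, Prod.mk_mul_mk, mul_one]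

theorem controlledSign_pairHom_mul_right {w : G} (hw : w * w = 1) (d d' : G) :
    controlledSign (pairHom (w, 1)) (pairHom (1, d * d')) =
      controlledSign (pairHom (w, 1)) (pairHom (1, d)) *
        controlledSign (pairHom (w, 1)) (pairHom (1, d')) := by
  rw [← controlledSign_mul_right _ (commute_pairHom (.one_right w) (.one_left d))
    (commute_pairHom (.one_right w) (.one_left d')) (pairHom_mul_self hw (mul_one 1)),
    ← map_mul, Prod.mk_mul_mk, mul_one]

/-- The controlled sign of w and z splits off once from each factor, and the two copies cancel. -/
theorem signElement_mul_mul {a z w : G} (d : G) (hz : z * z = 1) (hw : w * w = 1) :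
    signElement (a * w) z w (z * d) = signElement a z w d := by
  rw [signElement, signElement, controlledSign_pairHom_mul_left a w hz,
    controlledSign_pairHom_mul_right hw, mul_assoc,
    ← mul_assoc (controlledSign (pairHom (w, 1)) (pairHom (1, z))),
    controlledSign_pairHom_mul_self hw hz, one_mul]

theorem commute_phase_tmul_phase {z : G} (hz : ∀ g, Commute z g) (c : ℂ) (g h : G) :
    Commute (phase z c ⊗ₜ[ℂ] phase z c) (pairHom (g, h)) := by
  rw [pairHom_apply, Commute, SemiconjBy, Algebra.TensorProduct.tmul_mul_tmul,
    Algebra.TensorProduct.tmul_mul_tmul, (commute_phase hz c _).eq, (commute_phase hz c _).eq]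

theorem commute_phase_tmul_phase_signElement {z' : G} (hz' : ∀ g, Commute z' g) (c : ℂ)
    (a z w d : G) : Commute (phase z' c ⊗ₜ[ℂ] phase z' c) (signElement a z w d) :=
  (Commute.controlledSign_right (commute_phase_tmul_phase hz' c _ _)
    (commute_phase_tmul_phase hz' c _ _)).mul_right
  (Commute.controlledSign_right (commute_phase_tmul_phase hz' c _ _)
    (commute_phase_tmul_phase hz' c _ _))

/-- The intertwining relation between two coproducts can be checked on generators. -/
theorem mul_tmul_of_generators {t : Fin 6 → Fin 6 → List (Fin 6)}
    {φ : TableGroup t →* MonoidAlgebra ℂ G} {W : MonoidAlgebra ℂ G ⊗[ℂ] MonoidAlgebra ℂ G}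
    (h : ∀ i, W * (φ (.of i) ⊗ₜ φ (.of i)) = Coalgebra.comul (R := ℂ) (φ (.of i)) * W)
    (x : TableGroup t) : W * (φ x ⊗ₜ φ x) = Coalgebra.comul (R := ℂ) (φ x) * W := by
  induction x using TableGroup.induction with
  | one => rw [map_one, Bialgebra.comul_one, ← Algebra.TensorProduct.one_def, mul_one, one_mul]
  | of i => exact h i
  | mul x y hx hy =>
    rw [map_mul, Bialgebra.comul_mul, ← Algebra.TensorProduct.tmul_mul_tmul, ← mul_assoc, hx,
      mul_assoc, hy, mul_assoc]
  | inv x hx =>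
    have h1 : (φ x ⊗ₜ[ℂ] φ x) * (φ x⁻¹ ⊗ₜ[ℂ] φ x⁻¹) = 1 := by
      rw [Algebra.TensorProduct.tmul_mul_tmul, ← map_mul, mul_inv_cancel, map_one]
      rfl
    have h2 : Coalgebra.comul (R := ℂ) (φ x⁻¹) * Coalgebra.comul (R := ℂ) (φ x) = 1 := by
      rw [← Bialgebra.comul_mul, ← map_mul, inv_mul_cancel, map_one, Bialgebra.comul_one]
    calc W * (φ x⁻¹ ⊗ₜ φ x⁻¹)
        = Coalgebra.comul (R := ℂ) (φ x⁻¹) * (Coalgebra.comul (R := ℂ) (φ x) * W) *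
            (φ x⁻¹ ⊗ₜ φ x⁻¹) := by rw [← mul_assoc, h2, one_mul]
      _ = Coalgebra.comul (R := ℂ) (φ x⁻¹) * W * ((φ x ⊗ₜ φ x) * (φ x⁻¹ ⊗ₜ φ x⁻¹)) := by
        rw [← hx]; simp only [mul_assoc]
      _ = Coalgebra.comul (R := ℂ) (φ x⁻¹) * W := by rw [h1, mul_one]

end SemiconjPair

/-! ### The twist from `G3` to `G4` and the resulting equivalence -/

namespace UnitaryRep

variable {G : Type} [Group G]

theorem isSymmetric_tensorAction_signElement (U V : UnitaryRep G) {a z w d : G}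
    (ha : a * a = 1) (hz : z * z = 1) (hw : w * w = 1) (hd : d * d = 1) (haw : Commute a w)
    (hzd : Commute z d) : (tensorAction U V (signElement a z w d)).IsSymmetric := by
  rw [signElement, map_mul]
  exact (isSymmetric_tensorAction_controlledSign U V ha hz).mul_of_commute
    (isSymmetric_tensorAction_controlledSign U V hw hd)
    ((commute_signFactors haw hzd).map (tensorAction U V))

/-- Group elements act as 1 on the unit object, and a controlled sign with one argument 1 is 1; this
gives unitality. -/
theorem tensorAction_trivial_left (U : UnitaryRep G) (a z w d : G) :
    tensorAction trivial U (signElement a z w d) = 1 := by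
  have h : ∀ g : G, tensorAction trivial U (pairHom (g, 1)) = 1 := fun g => by
    rw [tensorAction_pairHom, map_one]
    exact TensorProduct.ext' fun x y => rfl
  rw [signElement, map_mul, map_controlledSign, map_controlledSign, h, h, controlledSign_one_left,
    controlledSign_one_left, one_mul]

theorem tensorAction_trivial_right (U : UnitaryRep G) (a z w d : G) :
    tensorAction U trivial (signElement a z w d) = 1 := by
  have h : ∀ g : G, tensorAction U trivial (pairHom (1, g)) = 1 := fun g => by
    rw [tensorAction_pairHom, map_one]
    exact TensorProduct.ext' fun x y => rfl
  rw [signElement, map_mul, map_controlledSign, map_controlledSign, h, h,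
    controlledSign_one_right, controlledSign_one_right, one_mul]

/-- The equivalence given by a twist comes from the twist. -/
theorem IsTensorStructure.comesFromTwist {H : Type} [Group H] {φ : H →* MonoidAlgebra ℂ G}
    {W : MonoidAlgebra ℂ G ⊗[ℂ] MonoidAlgebra ℂ G} (hW : IsTensorStructure φ W)
    (hφ : ∀ h, groupStar (φ h) = φ h⁻¹)
    (ψ : G →* MonoidAlgebra ℂ H) (hψ : ∀ g, groupStar (ψ g) = ψ g⁻¹)
    (hφψ : ∀ g, MonoidAlgebra.lift ℂ _ H φ (ψ g) = MonoidAlgebra.single g 1)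
    (hψφ : ∀ h, MonoidAlgebra.lift ℂ _ G ψ (φ h) = MonoidAlgebra.single h 1)
    {N : Subgroup G} {ω : CharGroup N → CharGroup N → Circle} (Φ : TwistIso H ω)
    (hΦ : ∀ h, Φ.toAlgEquiv (MonoidAlgebra.single h 1) = φ h) (hω : cocycleElement ω = W) :
    (hW.repEquivalence hφ ψ hψ hφψ hψφ).ComesFromTwist Φ := by
  refine ⟨fun U => LinearIsometryEquiv.refl ℂ U, fun U V f x => rfl, fun U h x => ?_,
    fun U V x y => ?_⟩
  · rw [hΦ]
    rfl
  · rw [hω]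
    rfl

end UnitaryRep

/-- The cocycle as an element of `ℂ[G3] ⊗ ℂ[G3]`. -/
def twistElement : MonoidAlgebra ℂ G3 ⊗[ℂ] MonoidAlgebra ℂ G3 :=
  signElement (.of 2) (.of 4) (.of 5) (.of 3)

theorem cocycleElement_twistCocycle : cocycleElement twistCocycle = twistElement := by
  rw [twistCocycle, cocycleElement_signCocycle (basis_mul_self 2) (basis_mul_self 1)]
  simp only [coe_basis]
  rfl

theorem cocycleElement_twistCocycle_inv :
    cocycleElement (fun σ τ => (twistCocycle σ τ)⁻¹) = twistElement := by
  rw [← cocycleElement_twistCocycle]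
  congr 1
  funext σ τ
  exact signCocycle_inv (basis_mul_self 0) (basis_mul_self 3) σ τ

theorem semiconjBy_of {x y y' : G3} (h : equiv3 x * equiv3 y = equiv3 y' * equiv3 x) :
    SemiconjBy x y y' := equiv3.injective (by rw [map_mul, map_mul, h])

/-- The heart of the construction: the images of the elements of `G4` are group-like for the twisted
coproduct. The generators f₁, f₂ and f₃,…,f₆ need different reasons. -/
theorem twistElement_mul_twist (h : G4) : twistElement * (twist h ⊗ₜ twist h) =
    Coalgebra.comul (R := ℂ) (twist h) * twistElement := by
  refine mul_tmul_of_generators (fun i => ?_) h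
  by_cases h1 : i = 1
  · subst h1
    have e : twistElement * (phase (.of 4) Complex.I ⊗ₜ phase (.of 4) Complex.I) =
        (phase (.of 4) Complex.I ⊗ₜ phase (.of 4) Complex.I) * twistElement :=
      (commute_phase_tmul_phase_signElement center3 _ _ _ _ _).symm.eq
    -- Conjugation by f₂ changes only f₃, to f₅f₃, which splits off the controlled sign of f₅ with
    -- itself. `comul_phase_I` absorbs it into the phase.
    have hs : SemiconjBy (pairHom ((.of 1 : G3), (.of 1 : G3))) twistElement
        (controlledSign (pairHom ((.of 4 : G3), 1)) (pairHom (1, (.of 4 : G3))) * twistElement) := by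
      have h := semiconjBy_signElement (x := (.of 1 : G3)) (a := .of 2) (z := .of 4) (w := .of 5)
        (d := .of 3) (a' := .of 4 * .of 2) (z' := .of 4) (w' := .of 5) (d' := .of 3)
        (semiconjBy_of (by simp only [map_mul, equiv3_of]; decide +kernel))
        (semiconjBy_of (by simp only [equiv3_of]; decide +kernel))
        (semiconjBy_of (by simp only [equiv3_of]; decide +kernel))
        (semiconjBy_of (by simp only [equiv3_of]; decide +kernel))
      rwa [signElement, signElement, controlledSign_pairHom_mul_left _ _ sq3, mul_assoc] at h
    rw [twist_of_one, ← Algebra.TensorProduct.tmul_mul_tmul, ← pairHom_apply, ← mul_assoc, e,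
      Bialgebra.comul_mul, comul_single_one, mul_assoc, mul_assoc, hs.eq, ← comul_phase_I sq3]
    simp only [mul_assoc]
  · rw [twist_of h1, comul_single_one, ← pairHom_apply]
    by_cases h0 : i = 0
    · subst h0
      -- Conjugation by f₁ changes f₃ and f₄ simultaneously, and `signElement_mul_mul` shows that
      -- the changes cancel.
      have h := semiconjBy_signElement (x := (.of 0 : G3)) (a := .of 2) (z := .of 4) (w := .of 5)
        (d := .of 3) (a' := .of 2 * .of 5) (z' := .of 4) (w' := .of 5) (d' := .of 4 * .of 3)
        (semiconjBy_of (by simp only [map_mul, equiv3_of]; decide +kernel))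
        (semiconjBy_of (by simp only [equiv3_of]; decide +kernel))
        (semiconjBy_of (by simp only [equiv3_of]; decide +kernel))
        (semiconjBy_of (by simp only [map_mul, equiv3_of]; decide +kernel))
      rw [signElement_mul_mul _ sq3 (TableGroup.of_mul_self rfl)] at h
      exact h.eq.symm
    · have hc : ∀ j : Fin 6, 2 ≤ j → Commute (.of i : G3) (.of j) := fun j hj =>
        TableGroup.commute_of (by revert i j; decide)
      exact (semiconjBy_signElement (hc 2 (by decide)) (hc 4 (by decide)) (hc 5 (by decide))
        (hc 3 (by decide))).eq.symm

theorem isTensorStructure_twist : UnitaryRep.IsTensorStructure twist twistElement := by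
  have hc : ∀ i j : Fin 6, 2 ≤ i → 2 ≤ j → Commute (.of i : G3) (.of j) := fun i j hi hj =>
    TableGroup.commute_of (by revert i j; decide)
  have hs : ∀ i : Fin 6, (.of i * .of i : G3) = 1 := fun i =>
    TableGroup.of_mul_self (by revert i; decide)
  exact
    { mul_self := signElement_mul_self (hs _) (hs _) (hs _) (hs _) (hc _ _ (by decide) (by decide))
        (hc _ _ (by decide) (by decide))
      symmetric := fun U V => UnitaryRep.isSymmetric_tensorAction_signElement U V (hs _) (hs _)
        (hs _) (hs _) (hc _ _ (by decide) (by decide)) (hc _ _ (by decide) (by decide))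
      mul_map := twistElement_mul_twist
      counit_map := counit_twist
      left_unit := fun U c x => by
        rw [twistElement, UnitaryRep.tensorAction_trivial_left, Module.End.one_apply]
      right_unit := fun U c x => by
        rw [twistElement, UnitaryRep.tensorAction_trivial_right, Module.End.one_apply]
      assoc := UnitaryRep.signElement_assoc (hs _) (hs _) (hs _) (hs _)
        (hc _ _ (by decide) (by decide)) (hc _ _ (by decide) (by decide))
        (hc _ _ (by decide) (by decide)) (hc _ _ (by decide) (by decide))
        (hc _ _ (by decide) (by decide)) (hc _ _ (by decide) (by decide)) }

/-- The isomorphism of `G4` with the twist of `G3`. -/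
def twistIso : TwistIso G4 twistCocycle where
  toAlgEquiv := twistEquiv
  map_star a := by
    change twistAlg (groupStar a) = groupStar (twistAlg a)
    induction a using MonoidAlgebra.induction_linear with
    | zero => rw [groupStar_zero, map_zero, groupStar_zero]
    | add a b ha hb => rw [groupStar_add, map_add, ha, hb, map_add, groupStar_add]
    | single h c =>
      rw [groupStar_single, twistAlg, MonoidAlgebra.lift_single, MonoidAlgebra.lift_single,
        groupStar_smul, groupStar_twist]
  map_comul a := by
    change cocycleElement _ * Coalgebra.comul (R := ℂ) (twistAlg a) * cocycleElement _ =
      TensorProduct.map twistAlg.toLinearMap twistAlg.toLinearMap (Coalgebra.comul (R := ℂ) a)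
    rw [cocycleElement_twistCocycle_inv, cocycleElement_twistCocycle]
    induction a using MonoidAlgebra.induction_linear with
    | zero => simp only [map_zero, mul_zero, zero_mul]
    | add a b ha hb => simp only [map_add, mul_add, add_mul, ha, hb]
    | single h c =>
      have e : MonoidAlgebra.single h c = c • MonoidAlgebra.single h (1 : ℂ) := by simp
      rw [e]
      simp only [map_smul, mul_smul_comm, smul_mul_assoc]
      rw [comul_single_one, pairHom_apply, TensorProduct.map_tmul]
      change c • _ = c • (twistAlg _ ⊗ₜ twistAlg _)
      -- Since W is its own inverse, conjugating the coproduct by W leaves the tensor square.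
      rw [twistAlg_single, mul_assoc, ← twistElement_mul_twist, ← mul_assoc,
        isTensorStructure_twist.mul_self, one_mul]

/-- The monoidal equivalence between `Rep G3` and `Rep G4`. -/
def twistRepEquivalence : RepEquivalence G3 G4 :=
  isTensorStructure_twist.repEquivalence groupStar_twist untwist groupStar_untwist
    twistAlg_untwist untwistAlg_twist

theorem comesFromTwist_twistRepEquivalence : twistRepEquivalence.ComesFromTwist twistIso := by
  refine UnitaryRep.IsTensorStructure.comesFromTwist _ _ _ _ _ _ _ twistAlg_single
    cocycleElement_twistCocycle

end

theorem mainTheorem2 :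
    Nat.card G3 = 64 ∧ Nat.card G4 = 64 ∧
    IsEmpty (G3 ≃* G4) ∧
    MonoidallyEquivalent G3 G4 ∧
    orderList G3 = [1, 31, 32, 0, 0, 0, 0] ∧
    orderList G4 = [1, 31, 32, 0, 0, 0, 0] ∧
    (∃ (N : Subgroup G3) (_ : N.Normal) (ω : CharGroup N → CharGroup N → Circle),
      Nonempty (N ≃* (Fin 4 → Multiplicative (ZMod 2))) ∧
      IsTwoCocycle ω ∧ IsInvariantCocycle ω ∧ IsNondegenerateCocycle ω ∧
      ∃ (Φ : TwistIso G4 ω) (E : RepEquivalence G3 G4), E.ComesFromTwist Φ) ∧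
    (IsEmpty (G3 ≃* G1) ∧ IsEmpty (G3 ≃* G2) ∧ IsEmpty (G4 ≃* G1) ∧ IsEmpty (G4 ≃* G2)) := by
  obtain ⟨f1, hf1⟩ := exists_surjective1
  obtain ⟨f2, hf2⟩ := exists_surjective2
  refine ⟨card_G3, card_G4, isEmpty_G3_mulEquiv_G4, ⟨twistRepEquivalence⟩, orderList_G3,
    orderList_G4, ⟨twistSubgroup, inferInstance, twistCocycle, ⟨twistSubgroupEquiv.symm⟩,
      isTwoCocycle_signCocycle (basis_mul_self 0) (basis_mul_self 2) (basis_mul_self 3)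
        (basis_mul_self 1),
      isInvariantCocycle_twistCocycle, isNondegenerateCocycle_twistCocycle, twistIso,
      twistRepEquivalence, comesFromTwist_twistRepEquivalence⟩, ?_, ?_, ?_, ?_⟩
  · exact isEmpty_mulEquiv_of_surjective f1 hf1 (BilinearExtension.card_eq _) card_G3
      (by rw [card_sq_eq_one_G3, card_sq_eq_one1]; decide)
  · exact isEmpty_mulEquiv_of_surjective f2 hf2 (BilinearExtension.card_eq _) card_G3
      (by rw [card_sq_eq_one_G3, card_sq_eq_one2]; decide)
  · exact isEmpty_mulEquiv_of_surjective f1 hf1 (BilinearExtension.card_eq _) card_G4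
      (by rw [card_sq_eq_one_G4, card_sq_eq_one1]; decide)
  · exact isEmpty_mulEquiv_of_surjective f2 hf2 (BilinearExtension.card_eq _) card_G4
      (by rw [card_sq_eq_one_G4, card_sq_eq_one2]; decide)
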